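/- Let $G\subset\mathbb R^3$ be a bounded open set with $C^\infty$ boundary and strictly convex closure $\overline G$, with unit outward normal $\nu$. Let $S\subset\mathbb R^3$ be the unit sphere, $I=[E_0,E_m]$ with $0\le E_0<E_m<\infty$, $I^\circ=\,]E_0,E_m[$, and let $m\in\mathbb N_0$. All functions are real valued, $L^p(G\times S\times I)$ refers to $dx\,d\omega\,dE$, and $$\Gamma_{\mp}=\{(y,\omega,E)\in\partial G\times S\times I:\ \pm\,\omega\cdot\nu(y)<0\},\qquad \Gamma_0=\{(y,\omega,E)\in\partial G\times S\times I:\ \omega\cdot\nu(y)=0\}.$$ *Spaces.* For $k\in\mathbb N_0\cup\{\infty\}$ let $C_0^{(k,0,0)}(\mathbb R^3\times S\times\mathbb R)$ be the compactly supported functions all of whose partial derivatives $\partial_x^\alpha$, $|\alpha|\le k$, exist and are continuous on $\mathbb R^3\times S\times\mathbb R$, and let $C^{(k,0,0)}(\overline G\times S\times I)$ be the set of their restrictions to $G\times S\times I^\circ$. Let $\mathcal D$ be the set of all $\psi\in\bigcap_{k\ge1}C^{(k,0,0)}(\overline G\times S\times I)$ whose support in $\overline G\times S\times I$ does not meet $\Gamma_-\cup\Gamma_0$.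 Let $H_0^{(m,0,0)}=H_0^{(m,0,0)}(G\times S\times I,\Gamma_-)$ be the completion of $\mathcal D$ for the inner product $\sum_{|\alpha|\le m}\langle\partial_x^\alpha\psi,\partial_x^\alpha v\rangle_{L^2(G\times S\times I)}$, and let $\mathcal W^{\infty,(m,0,0)}=\mathcal W^{\infty,(m,0,0)}(G\times S\times I)$ be the completion of $C^{(\infty,0,0)}(\overline G\times S\times I)$ for the norm $\|\Sigma\|=\max_{|\alpha|\le m}\|\partial_x^\alpha\Sigma\|_{L^\infty(G\times S\times I)}$. *The constant.* There is a constant $c(m)>0$, depending only on $m$, such that for all $\Sigma\in\mathcal W^{\infty,(m,0,0)}$ and $\psi\in H_0^{(m,0,0)}$ the product $\Sigma\psi$ belongs to $H_0^{(m,0,0)}$ and $$\|\Sigma\psi\|_{H_0^{(m,0,0)}}\le c(m)\,\|\Sigma\|\,\|\psi\|_{H_0^{(m,0,0)}}.\tag{1}$$ *The operator.* Let $\Sigma\in\mathcal W^{\infty,(m,0,0)}$. The operator $P_m\psi=\omega\cdot\nabla_x\psi+\Sigma\psi$ with domain $D(P_m)=\mathcal D$ maps into $H_0^{(m,0,0)}$,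 and the closure of its graph in $H_0^{(m,0,0)}\times H_0^{(m,0,0)}$ is the graph of a (single-valued) operator $\widetilde P_m$. **Theorem.** Let $c(m)>0$ be any constant for which (1) holds for all $\Sigma\in\mathcal W^{\infty,(m,0,0)}$ and $\psi\in H_0^{(m,0,0)}$. Let $\Sigma\in\mathcal W^{\infty,(m,0,0)}$ and $C'=c(m)\|\Sigma\|$. Then for every $C>C'$ $$R(\widetilde P_m+C\,\mathcal I)=H_0^{(m,0,0)}(G\times S\times I,\Gamma_-),$$ and for every $f\in H_0^{(m,0,0)}$ there is a unique strong solution of $$\omega\cdot\nabla_x\psi+\Sigma\psi+C\psi=f,\qquad \psi_{|\Gamma_-}=0,$$ that is, a unique $\psi\in D(\widetilde P_m)\subset H_0^{(m,0,0)}$ with $(\widetilde P_m+C\,\mathcal I)\psi=f$. This $\psi$ satisfies the equation and the inflow condition in the weak sense: $$\int_{G\times S\times I}(f-\Sigma\psi-C\psi)\,\varphi\;dx\,d\omega\,dE=-\int_{G\times S\times I}\psi\;\omega\cdot\nabla_x\varphi\;dx\,d\omega\,dE$$ for all $\varphi\in C^{(1,0,0)}(\overline G\times S\times I)$ whose support in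 $\overline G\times S\times I$ does not meet $\Gamma_+\cup\Gamma_0$. -/

import Mathlib

open MeasureTheory Set Filter Topology
open scoped ENNReal ContDiff

noncomputable section

namespace Transport

/-- Euclidean three-space. -/
abbrev V3 : Type := EuclideanSpace ℝ (Fin 3)

/-- The unit sphere `S` of three-space. -/
abbrev Sph : Type := Metric.sphere (0 : V3) 1

/-- The ambient phase space `ℝ³ × S × ℝ`, with points `(x, ω, E)`. -/
abbrev Phase : Type := V3 × Sph × ℝ

/-! ### The domain -/

/-- `ρ` is a smooth local defining function of `G` at `y`: the gradient of `ρ` does not vanish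
at `y`, and `G = {ρ < 0}` near `y`. -/
def IsLocalDefiningFunction (G : Set V3) (y : V3) (ρ : V3 → ℝ) : Prop :=
  ContDiff ℝ ∞ ρ ∧ gradient ρ y ≠ 0 ∧ ∀ᶠ x in 𝓝 y, (x ∈ G ↔ ρ x < 0)

/-- `G` is open and bounded with a `C^∞` boundary, and its closure is strictly convex. -/
structure IsSmoothStrictlyConvexDomain (G : Set V3) : Prop where
  isOpen : IsOpen G
  isBounded : Bornology.IsBounded G
  smooth_boundary : ∀ y ∈ frontier G, ∃ ρ : V3 → ℝ, IsLocalDefiningFunction G y ρ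
  strictConvex : StrictConvex ℝ (closure G)

/-- `n` is the unit outward normal of `G` at the boundary point `y`. -/
def IsOutwardNormal (G : Set V3) (y n : V3) : Prop :=
  ∃ ρ : V3 → ℝ, IsLocalDefiningFunction G y ρ ∧ n = ‖gradient ρ y‖⁻¹ • gradient ρ y

/-- `Γ₋ ∪ Γ₀`: the boundary points `(y, ω, E)`, `y ∈ ∂G`, `E ∈ [E₀, Eₘ]`, with `ω · ν(y) ≤ 0`. -/
def gammaMinusZero (G : Set V3) (E₀ Eₘ : ℝ) : Set Phase :=
  {z | z.1 ∈ frontier G ∧ z.2.2 ∈ Icc E₀ Eₘ ∧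
    ∃ n, IsOutwardNormal G z.1 n ∧ inner ℝ (z.2.1 : V3) n ≤ 0}

/-- `Γ₊ ∪ Γ₀`: the boundary points `(y, ω, E)`, `y ∈ ∂G`, `E ∈ [E₀, Eₘ]`, with `ω · ν(y) ≥ 0`. -/
def gammaPlusZero (G : Set V3) (E₀ Eₘ : ℝ) : Set Phase :=
  {z | z.1 ∈ frontier G ∧ z.2.2 ∈ Icc E₀ Eₘ ∧
    ∃ n, IsOutwardNormal G z.1 n ∧ 0 ≤ inner ℝ (z.2.1 : V3) n}

/-- `G × S × I°`, where `I° = ]E₀, Eₘ[`. -/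
def phaseInterior (G : Set V3) (E₀ Eₘ : ℝ) : Set Phase :=
  {z | z.1 ∈ G ∧ z.2.2 ∈ Ioo E₀ Eₘ}

/-- The measure `dx dω dE` on `G × S × I`, where `I = [E₀, Eₘ]` and `dω` is the surface measure
of the sphere. -/
def phaseMeasure (G : Set V3) (E₀ Eₘ : ℝ) : Measure Phase :=
  ((volume : Measure V3).restrict G).prod
    ((volume : Measure V3).toSphere.prod ((volume : Measure ℝ).restrict (Icc E₀ Eₘ)))

/-! ### Functions that are smooth in the space variable -/

/-- The partial derivative `∂f/∂xᵢ`. -/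
def pd (i : Fin 3) (f : Phase → ℝ) : Phase → ℝ := fun z =>
  lineDeriv ℝ (fun x => f (x, z.2)) z.1 (EuclideanSpace.single i 1)

/-- The derivative `∂ₓ^α f` for a multi-index `α`. -/
def pdMulti (α : Fin 3 → ℕ) (f : Phase → ℝ) : Phase → ℝ :=
  (pd 0)^[α 0] ((pd 1)^[α 1] ((pd 2)^[α 2] f))

/-- The streaming term `ω · ∇ₓ f`. -/
def advect (f : Phase → ℝ) : Phase → ℝ := fun z => ∑ i, (z.2.1 : V3) i * pd i f z

/-- `f ∈ C^{(k,0,0)}(ℝ³ × S × ℝ)`: all partial derivatives of `f` in `x` of order at most `k`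
exist and are continuous on `ℝ³ × S × ℝ`. -/
def IsCx : ℕ → (Phase → ℝ) → Prop
  | 0, f => Continuous f
  | k + 1, f => Continuous f ∧ ∀ i : Fin 3,
      (∀ z : Phase,
        LineDifferentiableAt ℝ (fun x => f (x, z.2)) z.1 (EuclideanSpace.single i 1)) ∧
      IsCx k (pd i f)

/-- `f ∈ C₀^{(k,0,0)}(ℝ³ × S × ℝ)`: in addition the support of `f` is compact. -/
def IsCxCompact (k : ℕ) (f : Phase → ℝ) : Prop := IsCx k f ∧ HasCompactSupport f

/-- `ψ ∈ C₀^{(k,0,0)}(Ḡ × S × I, Γ₋)`: on `G × S × I°` the function `ψ` is the restriction of an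
element of `C₀^{(k,0,0)}(ℝ³ × S × ℝ)`, and the support of `ψ` in `Ḡ × S × I` does not meet
`Γ₋ ∪ Γ₀`. The values of `ψ` outside `G × S × I°` play no role. -/
def IsInflowVanishing (G : Set V3) (E₀ Eₘ : ℝ) (k : ℕ) (ψ : Phase → ℝ) : Prop :=
  (∃ f, IsCxCompact k f ∧ EqOn ψ f (phaseInterior G E₀ Eₘ)) ∧
    Disjoint (closure (Function.support ψ ∩ phaseInterior G E₀ Eₘ)) (gammaMinusZero G E₀ Eₘ)

/-- The intersection of the spaces `C₀^{(k,0,0)}(Ḡ × S × I, Γ₋)` over all `k ≥ 1`. -/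
def smoothSpace (G : Set V3) (E₀ Eₘ : ℝ) : Set (Phase → ℝ) :=
  {ψ | ∀ k : ℕ, 1 ≤ k → IsInflowVanishing G E₀ Eₘ k ψ}

/-! ### The function spaces -/

/-- Multi-indices `α ∈ ℕ₀³` with `|α| ≤ m`. -/
abbrev MultiIndex (m : ℕ) : Type := {α : Fin 3 → Fin (m + 1) // ∑ i, (α i : ℕ) ≤ m}

/-- The multi-index zero. -/
def zeroIndex (m : ℕ) : MultiIndex m := ⟨fun _ => 0, by simp⟩

/-- Families `(u_α)`, `|α| ≤ m`, in `L²(G × S × I)`, with the Hilbert space norm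
`‖u‖² = ∑_α ‖u_α‖²`. An element `ψ` of `H^{(m,0,0)}(G × S × I)` is represented isometrically by the
family `(∂ₓ^α ψ)`; the function itself is the component with index zero. -/
abbrev L2Jet (m : ℕ) (G : Set V3) (E₀ Eₘ : ℝ) : Type :=
  PiLp 2 (fun _ : MultiIndex m => Lp ℝ 2 (phaseMeasure G E₀ Eₘ))

/-- Families `(s_α)`, `|α| ≤ m`, in `L^∞(G × S × I)`, with the norm `‖s‖ = max_α ‖s_α‖`. An element
`Σ` of `W^{∞,(m,0,0)}(G × S × I)` is represented by the family `(∂ₓ^α Σ)`. -/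
abbrev LinftyJet (m : ℕ) (G : Set V3) (E₀ Eₘ : ℝ) : Type :=
  MultiIndex m → Lp ℝ ∞ (phaseMeasure G E₀ Eₘ)

/-- `u` is the family of the derivatives `∂ₓ^α ψ`, `|α| ≤ m`. -/
def IsL2Jet {m : ℕ} {G : Set V3} {E₀ Eₘ : ℝ} (ψ : Phase → ℝ) (u : L2Jet m G E₀ Eₘ) : Prop :=
  ∀ α : MultiIndex m, u α =ᵐ[phaseMeasure G E₀ Eₘ] pdMulti (fun i => (α.1 i : ℕ)) ψ

/-- `s` is the family of the derivatives `∂ₓ^α ϕ`, `|α| ≤ m`. -/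
def IsLinftyJet {m : ℕ} {G : Set V3} {E₀ Eₘ : ℝ} (ϕ : Phase → ℝ) (s : LinftyJet m G E₀ Eₘ) :
    Prop :=
  ∀ α : MultiIndex m, s α =ᵐ[phaseMeasure G E₀ Eₘ] pdMulti (fun i => (α.1 i : ℕ)) ϕ

/-- The space `H₀^{(m,0,0)}(G × S × I, Γ₋)`: the completion of `smoothSpace` for the inner product
`∑_{|α| ≤ m} ⟨∂ₓ^α ψ, ∂ₓ^α v⟩`, realized as a closure in the complete space `L2Jet`. -/
def H0 (m : ℕ) (G : Set V3) (E₀ Eₘ : ℝ) : Set (L2Jet m G E₀ Eₘ) :=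
  closure {u | ∃ ψ ∈ smoothSpace G E₀ Eₘ, IsL2Jet ψ u}

/-- The space `𝒲^{∞,(m,0,0)}(G × S × I)`: the completion of `C^{(∞,0,0)}(Ḡ × S × I)` (the
restrictions of the compactly supported `C^{(∞,0,0)}` functions on `ℝ³ × S × ℝ`) for the norm of
`W^{∞,(m,0,0)}`. -/
def coeffSpace (m : ℕ) (G : Set V3) (E₀ Eₘ : ℝ) : Set (LinftyJet m G E₀ Eₘ) :=
  closure {s | ∃ ϕ : Phase → ℝ, (∀ k, IsCxCompact k ϕ) ∧ IsLinftyJet ϕ s}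

/-- Multiplication by elements of `𝒲^{∞,(m,0,0)}` maps `H₀^{(m,0,0)}` to itself, with
`‖Σ ψ‖ ≤ c ‖Σ‖ ‖ψ‖`. -/
def MultiplicationBound (m : ℕ) (G : Set V3) (E₀ Eₘ c : ℝ) : Prop :=
  ∀ s ∈ coeffSpace m G E₀ Eₘ, ∀ u ∈ H0 m G E₀ Eₘ, ∃ g ∈ H0 m G E₀ Eₘ,
    (g (zeroIndex m) =ᵐ[phaseMeasure G E₀ Eₘ]
      fun z => s (zeroIndex m) z * u (zeroIndex m) z) ∧
    ‖g‖ ≤ c * ‖s‖ * ‖u‖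

/-! ### The transport operator -/

/-- The graph of the operator `P_m ψ = ω · ∇ₓ ψ + Σ ψ` in `H₀^{(m,0,0)}`, whose domain is
`smoothSpace`. -/
def transportGraph {m : ℕ} {G : Set V3} {E₀ Eₘ : ℝ} (s : LinftyJet m G E₀ Eₘ) :
    Set (L2Jet m G E₀ Eₘ × L2Jet m G E₀ Eₘ) :=
  {p | ∃ ψ ∈ smoothSpace G E₀ Eₘ, IsL2Jet ψ p.1 ∧ p.2 ∈ H0 m G E₀ Eₘ ∧
    p.2 (zeroIndex m) =ᵐ[phaseMeasure G E₀ Eₘ]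
      fun z => advect ψ z + s (zeroIndex m) z * ψ z}

/-- The graph of the smallest closed extension of `P_m`. -/
def closedTransportGraph {m : ℕ} {G : Set V3} {E₀ Eₘ : ℝ} (s : LinftyJet m G E₀ Eₘ) :
    Set (L2Jet m G E₀ Eₘ × L2Jet m G E₀ Eₘ) :=
  closure (transportGraph s)

/-- `u` is a strong solution of `ω · ∇ₓ ψ + Σ ψ + C ψ = f`, `ψ = 0` on `Γ₋`: it lies in the domain
of the closed operator, and its image under that operator is `f - C u`. -/
def IsStrongSolution {m : ℕ} {G : Set V3} {E₀ Eₘ : ℝ} (s : LinftyJet m G E₀ Eₘ) (C : ℝ)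
    (f u : L2Jet m G E₀ Eₘ) : Prop :=
  (u, f - C • u) ∈ closedTransportGraph s

/-- The equation `ω · ∇ₓ ψ + Σ ψ + C ψ = f` and the inflow condition `ψ = 0` on `Γ₋`, in the
weak sense of Green's formula: the test functions are arbitrary near `Γ₋` and vanish
near `Γ₊ ∪ Γ₀`. -/
def SolvesInflowProblem {m : ℕ} {G : Set V3} {E₀ Eₘ : ℝ} (s : LinftyJet m G E₀ Eₘ) (C : ℝ)
    (f u : L2Jet m G E₀ Eₘ) : Prop :=
  ∀ φ : Phase → ℝ, IsCxCompact 1 φ →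
    Disjoint (closure (Function.support φ ∩ phaseInterior G E₀ Eₘ)) (gammaPlusZero G E₀ Eₘ) →
    ∫ z, (f (zeroIndex m) z - s (zeroIndex m) z * u (zeroIndex m) z - C * u (zeroIndex m) z) * φ z
        ∂(phaseMeasure G E₀ Eₘ) =
      -∫ z, u (zeroIndex m) z * advect φ z ∂(phaseMeasure G E₀ Eₘ)

end Transport

end

/-!
Write `A` for the closure of the streaming operator `ω · ∇ₓ` in `H₀^{(m,0,0)}`. For smooth `χ` the
equation `ω · ∇ₓ ψ + C ψ = χ` is solved by integration along characteristics,
`ψ(x, ω, E) = ∫₀^∞ e^{-Ct} χ(x - tω, ω, E) dt`. Since `G` is convex, a point moving in the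
direction `ω` leaves `Ḡ` only through `Γ₊`, so that `ψ` still vanishes near `Γ₋ ∪ Γ₀`. For the same
reason the part of the mass of `ψ²` that lies in `G` cannot grow under translation along `ω`; hence
`⟨ω · ∇ₓ ψ, ψ⟩ ≥ 0`, and as `ω · ∇ₓ` commutes with `∂ₓ^α`, the operator `A` is accretive in `H₀`.
Therefore `A + C` is a bijection onto `H₀` and its inverse has norm at most `1 / C`.

The other components of an element of `H₀` are the weak derivatives of its zeroth component, which
therefore determines it. This makes `A` single-valued and identifies the closure of `P_m` with
`A + Σ`, where `Σ` acts by the Leibniz formula. As the norm of this multiplication is at most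
`c(m) ‖Σ‖ < C`, Banach's fixed point theorem for `u ↦ (A + C)⁻¹ (f - Σ u)` gives the unique strong
solution. Both sides of Green's formula are continuous in the graph norm of `A`, so it passes from
smooth functions to strong solutions.
-/

noncomputable section

namespace Transport

/-! ### Continuous partial derivatives -/

section PartialDerivatives

variable {ι E F W : Type*} [NormedAddCommGroup E] [NormedSpace ℝ E]
  [NormedAddCommGroup F] [NormedSpace ℝ F] [NormedAddCommGroup W] [NormedSpace ℝ W]

theorem hasDerivAt_lineMap_of_hasLineDerivAt {g : E → F} {g' : F} {x v : E} {t : ℝ}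
    (h : HasLineDerivAt ℝ g g' (x + t • v) v) : HasDerivAt (fun r : ℝ => g (x + r • v)) g' t := by
  have h₀ : HasDerivAt (fun r : ℝ => g (x + t • v + r • v)) g' (t - t) := by rwa [sub_self]
  have h₁ := h₀.comp_sub_const t t
  simp only [add_assoc, ← add_smul, add_sub_cancel] at h₁
  exact h₁

theorem hasFDerivAt_add_sum_smul {g : E → F} {v : ι → E} {g' : ι → E → F}
    (hc : ∀ i, Continuous (g' i)) (hd : ∀ i x, HasLineDerivAt ℝ g (g' i x) x (v i))
    (L : ι → W →L[ℝ] ℝ) (s : Finset ι) (x : E) (w : W) :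
    HasFDerivAt (fun w => g (x + ∑ i ∈ s, L i w • v i))
      (∑ i ∈ s, (L i).smulRight (g' i (x + ∑ j ∈ s, L j w • v j))) w := by
  classical
  induction s using Finset.induction_on generalizing x w with
  | empty => simpa using hasFDerivAt_const (g x) w
  | insert a s ha ih =>
    let p : ℝ → W → E := fun t w => (x + ∑ i ∈ s, L i w • v i) + t • v a
    have hp : Continuous (Function.uncurry p) := by fun_prop
    have hp_swap (t : ℝ) (w : W) : p t w = (x + t • v a) + ∑ i ∈ s, L i w • v i :=
      add_right_comm _ _ _
    let f₁ : ℝ → W → ℝ →L[ℝ] F := fun t w =>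
      ContinuousLinearMap.toSpanSingleton ℝ (g' a (p t w))
    let f₂ : ℝ → W → W →L[ℝ] F := fun t w => ∑ i ∈ s, (L i).smulRight (g' i (p t w))
    have hf₁ (q : ℝ × W) : HasFDerivAt (fun t => g (p t q.2)) (f₁ q.1 q.2) q.1 :=
      (hasDerivAt_lineMap_of_hasLineDerivAt (hd a _)).hasFDerivAt
    have hf₂ (q : ℝ × W) : HasFDerivAt (fun w => g (p q.1 w)) (f₂ q.1 q.2) q.2 := by
      simpa only [f₂, hp_swap] using ih (x + q.1 • v a) q.2
    have hcont₁ : Continuous (Function.uncurry f₁) :=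
      (ContinuousLinearMap.toSpanSingletonCLE (𝕜 := ℝ) (E := F)).continuous.comp ((hc a).comp hp)
    have hcont₂ : Continuous (Function.uncurry f₂) :=
      continuous_finsetSum _ fun i _ =>
        (ContinuousLinearMap.smulRightL ℝ W F (L i)).continuous.comp ((hc i).comp hp)
    let Q : W →L[ℝ] ℝ × W := (L a).prod (.id ℝ W)
    have huncurry := (hasStrictFDerivAt_uncurry_coprod (u := Q w)
      (f := fun t w => g (p t w)) (f₁ := f₁) (f₂ := f₂) (.of_forall hf₁) (.of_forall hf₂)
      hcont₁.continuousAt hcont₂.continuousAt).hasFDerivAt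
    have hcomp := huncurry.comp w Q.hasFDerivAt
    have hsum (w : W) : x + ∑ i ∈ insert a s, L i w • v i = p (L a w) w := by
      rw [Finset.sum_insert ha, hp_swap, add_assoc]
    simp only [hsum]
    rw [Finset.sum_insert ha]
    refine hcomp.congr_fderiv ?_
    ext u
    simp [Q, f₁, f₂, Function.HasUncurry.uncurry]

theorem hasFDerivAt_of_continuous_partials [Fintype ι] {g : E → F} {v : ι → E} {g' : ι → E → F}
    (hc : ∀ i, Continuous (g' i)) (hd : ∀ i x, HasLineDerivAt ℝ g (g' i x) x (v i))
    {L : ι → E →L[ℝ] ℝ} (hL : ∀ x, ∑ i, L i x • v i = x) (x : E) :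
    HasFDerivAt g (∑ i, (L i).smulRight (g' i x)) x := by
  simpa only [zero_add, hL] using hasFDerivAt_add_sum_smul hc hd L Finset.univ 0 x

end PartialDerivatives

theorem nonpos_of_hasDerivAt_of_eventually_le {f : ℝ → ℝ} {f' a : ℝ} (hf : HasDerivAt f f' a)
    (hle : ∀ᶠ t in 𝓝[>] a, f t ≤ f a) : f' ≤ 0 := by
  have hslope := (hasDerivWithinAt_iff_tendsto_slope' (s := Ioi a) (by simp)).1
    hf.hasDerivWithinAt
  refine le_of_tendsto hslope ?_
  filter_upwards [self_mem_nhdsWithin, hle] with t hat hle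
  rw [slope_def_field]
  exact div_nonpos_of_nonpos_of_nonneg (sub_nonpos.2 hle) (sub_nonneg.2 (mem_Ioi.1 hat).le)

theorem hasLineDerivAt_mul {E : Type*} [NormedAddCommGroup E] [NormedSpace ℝ E] {f g : E → ℝ}
    {f' g' : ℝ} {x v : E} (hf : HasLineDerivAt ℝ f f' x v) (hg : HasLineDerivAt ℝ g g' x v) :
    HasLineDerivAt ℝ (fun y => f y * g y) (f' * g x + f x * g') x v := by
  simpa [HasLineDerivAt] using HasDerivAt.fun_mul (x := (0 : ℝ)) hf hg

/-! ### Functions that are smooth in the space variable -/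

/-- The standard basis vectors of three-space. -/
abbrev basisVec (i : Fin 3) : V3 := EuclideanSpace.single i 1

theorem IsCx.continuous {k : ℕ} {f : Phase → ℝ} (hf : IsCx k f) : Continuous f := by
  cases k with
  | zero => exact hf
  | succ k => exact hf.1

theorem IsCx.pd {k : ℕ} {f : Phase → ℝ} (hf : IsCx (k + 1) f) (i : Fin 3) : IsCx k (pd i f) :=
  (hf.2 i).2

theorem IsCx.pred {k : ℕ} {f : Phase → ℝ} (hf : IsCx (k + 1) f) : IsCx k f := by
  induction k generalizing f with
  | zero => exact hf.continuous
  | succ k ih => exact ⟨hf.continuous, fun i => ⟨(hf.2 i).1, ih (hf.pd i)⟩⟩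

theorem IsCx.mono {k l : ℕ} {f : Phase → ℝ} (hf : IsCx k f) (h : l ≤ k) : IsCx l f := by
  induction k, h using Nat.le_induction with
  | base => exact hf
  | succ k _ ih => exact ih hf.pred

theorem IsCx.hasLineDerivAt {k : ℕ} {f : Phase → ℝ} (hf : IsCx (k + 1) f) (i : Fin 3) (x : V3)
    (p : Sph × ℝ) :
    HasLineDerivAt ℝ (fun x => f (x, p)) (Transport.pd i f (x, p)) x (basisVec i) :=
  ((hf.2 i).1 (x, p)).hasLineDerivAt

theorem IsCx.of_hasLineDerivAt {k : ℕ} {f : Phase → ℝ} {g : Fin 3 → Phase → ℝ}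
    (hf : Continuous f)
    (hd : ∀ i x p, HasLineDerivAt ℝ (fun x => f (x, p)) (g i (x, p)) x (basisVec i))
    (hg : ∀ i, IsCx k (g i)) : IsCx (k + 1) f := by
  refine ⟨hf, fun i => ⟨fun z => (hd i z.1 z.2).lineDifferentiableAt, ?_⟩⟩
  have hpd : Transport.pd i f = g i := funext fun z => (hd i z.1 z.2).lineDeriv
  exact hpd ▸ hg i

theorem IsCx.hasFDerivAt {k : ℕ} {f : Phase → ℝ} (hf : IsCx (k + 1) f) (x : V3) (p : Sph × ℝ) :
    HasFDerivAt (fun x => f (x, p))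
      (∑ i, (EuclideanSpace.proj i : V3 →L[ℝ] ℝ).smulRight (Transport.pd i f (x, p))) x :=
  hasFDerivAt_of_continuous_partials (g' := fun i x => Transport.pd i f (x, p))
    (fun i => (hf.pd i).continuous.comp (by fun_prop)) (fun i x => hf.hasLineDerivAt i x p)
    (fun x => by ext j; simp [Pi.single_apply]) x

theorem IsCx.contDiff {k : ℕ} {f : Phase → ℝ} (hf : IsCx k f) (p : Sph × ℝ) :
    ContDiff ℝ k (fun x => f (x, p)) := by
  induction k generalizing f with
  | zero => exact_mod_cast contDiff_zero.2 (hf.continuous.comp (by fun_prop))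
  | succ k ih =>
    push_cast
    refine contDiff_succ_iff_hasFDerivAt.2 ⟨_, ?_, fun x => hf.hasFDerivAt x p⟩
    exact ContDiff.sum fun i _ => contDiff_const.smulRight (ih (hf.pd i))

theorem IsCx.of_snd (k : ℕ) {b : Sph × ℝ → ℝ} (hb : Continuous b) : IsCx k (fun z => b z.2) := by
  induction k generalizing b with
  | zero => exact hb.comp continuous_snd
  | succ k ih =>
    exact IsCx.of_hasLineDerivAt (g := fun _ _ => 0) (hb.comp continuous_snd)
      (fun _ _ p => hasDerivAt_const (0 : ℝ) (b p)) fun _ => ih continuous_const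

theorem IsCx.add {k : ℕ} {f g : Phase → ℝ} (hf : IsCx k f) (hg : IsCx k g) :
    IsCx k (fun z => f z + g z) := by
  induction k generalizing f g with
  | zero => exact Continuous.add hf hg
  | succ k ih =>
    exact IsCx.of_hasLineDerivAt (hf.continuous.add hg.continuous)
      (g := fun i z => Transport.pd i f z + Transport.pd i g z)
      (fun i x p => HasDerivAt.fun_add (hf.hasLineDerivAt i x p) (hg.hasLineDerivAt i x p))
      (fun i => ih (hf.pd i) (hg.pd i))

theorem IsCx.mul {k : ℕ} {f g : Phase → ℝ} (hf : IsCx k f) (hg : IsCx k g) :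
    IsCx k (fun z => f z * g z) := by
  induction k generalizing f g with
  | zero => exact Continuous.mul hf hg
  | succ k ih =>
    exact IsCx.of_hasLineDerivAt (hf.continuous.mul hg.continuous)
      (g := fun i z => Transport.pd i f z * g z + f z * Transport.pd i g z)
      (fun i x p => hasLineDerivAt_mul (hf.hasLineDerivAt i x p) (hg.hasLineDerivAt i x p))
      (fun i => (ih (hf.pd i) hg.pred).add (ih hf.pred (hg.pd i)))

theorem IsCx.sum {k : ℕ} {ι : Type*} {s : Finset ι} {f : ι → Phase → ℝ}
    (hf : ∀ i ∈ s, IsCx k (f i)) : IsCx k (fun z => ∑ i ∈ s, f i z) := by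
  classical
  induction s using Finset.induction_on with
  | empty => simpa using IsCx.of_snd k continuous_const
  | insert a s ha ih =>
    simp only [Finset.sum_insert ha]
    exact (hf a (by simp)).add (ih fun i hi => hf i (by simp [hi]))

theorem pd_mul {f g : Phase → ℝ} (hf : IsCx 1 f) (hg : IsCx 1 g) (i : Fin 3) (z : Phase) :
    pd i (fun z => f z * g z) z = pd i f z * g z + f z * pd i g z :=
  (hasLineDerivAt_mul (hf.hasLineDerivAt i z.1 z.2) (hg.hasLineDerivAt i z.1 z.2)).lineDeriv

/-! ### Directional derivatives -/

/-- The derivative in the space variable along a direction that depends on `(ω, E)`; both `pd i`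
and `advect` are of this form. -/
def dirDeriv (v : Sph × ℝ → V3) (f : Phase → ℝ) : Phase → ℝ := fun z => ∑ i, v z.2 i * pd i f z

/-- The direction field `ω` of the streaming term. -/
def direction : Sph × ℝ → V3 := fun p => p.1

theorem continuous_direction : Continuous direction := by unfold direction; fun_prop

theorem dirDeriv_direction (f : Phase → ℝ) : dirDeriv direction f = advect f := rfl

theorem dirDeriv_basisVec (i : Fin 3) (f : Phase → ℝ) :
    dirDeriv (fun _ => basisVec i) f = pd i f := by
  funext z
  simp [dirDeriv]

theorem dirDeriv_mul (v : Sph × ℝ → V3) {f g : Phase → ℝ} (hf : IsCx 1 f) (hg : IsCx 1 g)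
    (z : Phase) :
    dirDeriv v (fun z => f z * g z) z = dirDeriv v f z * g z + f z * dirDeriv v g z := by
  simp only [dirDeriv, pd_mul hf hg, Fin.sum_univ_three]
  ring

theorem pd_congr {U : Set Phase} (hU : IsOpen U) {f g : Phase → ℝ} (h : EqOn f g U) (i : Fin 3) :
    EqOn (pd i f) (pd i g) U := by
  rintro ⟨x, p⟩ hz
  have hc : Continuous fun x' : V3 => ((x', p) : Phase) := by fun_prop
  refine Filter.EventuallyEq.lineDeriv_eq ?_
  filter_upwards [(hU.preimage hc).mem_nhds hz] with x' hx' using h hx'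

theorem dirDeriv_congr {U : Set Phase} (hU : IsOpen U) {f g : Phase → ℝ} (h : EqOn f g U)
    (v : Sph × ℝ → V3) : EqOn (dirDeriv v f) (dirDeriv v g) U := fun z hz => by
  simp only [dirDeriv, pd_congr hU h _ hz]

theorem dirDeriv_zero (v : Sph × ℝ → V3) (z : Phase) : dirDeriv v (fun _ => 0) z = 0 := by
  have hpd (i : Fin 3) : pd i (fun _ => 0) z = 0 := (hasDerivAt_const (0 : ℝ) (0 : ℝ)).deriv
  simp [dirDeriv, hpd]

theorem dirDeriv_eq_zero_of_notMem_tsupport (v : Sph × ℝ → V3) {f : Phase → ℝ} {z : Phase}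
    (hz : z ∉ tsupport f) : dirDeriv v f z = 0 := by
  have h : EqOn f (fun _ => 0) (tsupport f)ᶜ := fun z hz => image_eq_zero_of_notMem_tsupport hz
  rw [dirDeriv_congr (isClosed_tsupport f).isOpen_compl h v hz, dirDeriv_zero]

theorem IsCx.dirDeriv {k : ℕ} {f : Phase → ℝ} (hf : IsCx (k + 1) f) {v : Sph × ℝ → V3}
    (hv : Continuous v) : IsCx k (dirDeriv v f) :=
  IsCx.sum fun i _ => (IsCx.of_snd k (b := fun p => v p i) (by fun_prop)).mul (hf.pd i)

theorem IsCxCompact.dirDeriv {k : ℕ} {f : Phase → ℝ} (hf : IsCxCompact (k + 1) f)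
    {v : Sph × ℝ → V3} (hv : Continuous v) : IsCxCompact k (dirDeriv v f) :=
  ⟨hf.1.dirDeriv hv, .intro hf.2 fun _ => dirDeriv_eq_zero_of_notMem_tsupport v⟩

theorem IsCxCompact.pd {k : ℕ} {f : Phase → ℝ} (hf : IsCxCompact (k + 1) f) (i : Fin 3) :
    IsCxCompact k (pd i f) := by
  simpa only [dirDeriv_basisVec] using hf.dirDeriv (v := fun _ => basisVec i) continuous_const

theorem IsCxCompact.mono {k l : ℕ} {f : Phase → ℝ} (hf : IsCxCompact k f) (h : l ≤ k) :
    IsCxCompact l f :=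
  ⟨hf.1.mono h, hf.2⟩

theorem IsCxCompact.add {k : ℕ} {f g : Phase → ℝ} (hf : IsCxCompact k f) (hg : IsCxCompact k g) :
    IsCxCompact k (fun z => f z + g z) :=
  ⟨hf.1.add hg.1, hf.2.add hg.2⟩

theorem IsCxCompact.mul_left {k : ℕ} {f g : Phase → ℝ} (hf : IsCx k f) (hg : IsCxCompact k g) :
    IsCxCompact k (fun z => f z * g z) :=
  ⟨hf.mul hg.1, hg.2.mul_left⟩

theorem IsCxCompact.integrable {k : ℕ} {f : Phase → ℝ} (hf : IsCxCompact k f) {ν : Measure Phase}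
    [IsFiniteMeasureOnCompacts ν] : Integrable f ν :=
  hf.1.continuous.integrable_of_hasCompactSupport hf.2

/-! ### Cutoff functions -/

/-- The inclusion of the phase space into a linear space, where smooth cutoff functions exist. -/
def toAmbient (z : Phase) : V3 × V3 × ℝ := (z.1, (z.2.1 : V3), z.2.2)

theorem isClosedEmbedding_toAmbient : IsClosedEmbedding toAmbient :=
  IsClosedEmbedding.id.prodMap
    (Metric.isClosed_sphere.isClosedEmbedding_subtypeVal.prodMap .id)

theorem IsCx.comp_toAmbient (k : ℕ) {X : V3 × V3 × ℝ → ℝ} (hX : ContDiff ℝ ∞ X) :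
    IsCx k (fun z => X (toAmbient z)) := by
  have hcont {Y : V3 × V3 × ℝ → ℝ} (hY : ContDiff ℝ ∞ Y) : Continuous fun z => Y (toAmbient z) :=
    hY.continuous.comp isClosedEmbedding_toAmbient.continuous
  induction k generalizing X with
  | zero => exact hcont hX
  | succ k ih =>
    refine IsCx.of_hasLineDerivAt (hcont hX)
      (g := fun i z => fderiv ℝ X (toAmbient z) (basisVec i, 0, 0)) (fun i x p => ?_)
      (fun i => ih ((hX.fderiv_right (m := ∞) (by simp)).clm_apply contDiff_const))
    have h := (hX.differentiable (by simp) (toAmbient (x, p))).hasFDerivAt.hasLineDerivAt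
      (basisVec i, 0, 0)
    simpa [HasLineDerivAt, toAmbient] using h

theorem exists_cutoff {K U : Set Phase} (hK : IsClosed K) (hU : IsOpen U) (hKU : K ⊆ U) :
    ∃ χ : Phase → ℝ, (∀ k, IsCx k χ) ∧ (∀ z ∈ K, χ z = 1) ∧ tsupport χ ⊆ U := by
  obtain ⟨V, hV, hKV, hVU⟩ := normal_exists_closure_subset hK hU hKU
  obtain ⟨f, hf0, hf1, -⟩ := exists_contMDiffMap_zero_one_of_isClosed
    (modelWithCornersSelf ℝ (V3 × V3 × ℝ)) (n := ⊤)
    (isClosedEmbedding_toAmbient.isClosedMap _ hV.isClosed_compl)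
    (isClosedEmbedding_toAmbient.isClosedMap _ hK)
    ((disjoint_image_iff isClosedEmbedding_toAmbient.injective).2
      (disjoint_compl_left_iff_subset.2 hKV))
  refine ⟨fun z => f (toAmbient z), fun k => IsCx.comp_toAmbient k f.contMDiff.contDiff,
    fun z hz => hf1 (mem_image_of_mem _ hz), (closure_mono fun z hz => ?_).trans hVU⟩
  by_contra hzV
  exact hz (hf0 (mem_image_of_mem _ hzV))

theorem exists_compact_cutoff {K : Set Phase} (hK : IsCompact K) :
    ∃ χ : Phase → ℝ, (∀ k, IsCxCompact k χ) ∧ ∀ z ∈ K, χ z = 1 := by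
  obtain ⟨L, hL, hKL⟩ := exists_compact_superset hK
  obtain ⟨χ, hχ, hχ1, hχL⟩ := exists_cutoff hK.isClosed isOpen_interior hKL
  exact ⟨χ, fun k => ⟨hχ k, hL.of_isClosed_subset (isClosed_tsupport χ)
    (hχL.trans interior_subset)⟩, hχ1⟩

/-! ### The phase space measure and translations -/

/-- The measure `dx dω dE` on `ℝ³ × S × I`. -/
def fullMeasure (E₀ Eₘ : ℝ) : Measure Phase :=
  (volume : Measure V3).prod
    ((volume : Measure V3).toSphere.prod ((volume : Measure ℝ).restrict (Icc E₀ Eₘ)))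

instance (E₀ Eₘ : ℝ) : IsFiniteMeasureOnCompacts (fullMeasure E₀ Eₘ) := by
  unfold fullMeasure; infer_instance

instance (G : Set V3) (E₀ Eₘ : ℝ) : IsFiniteMeasureOnCompacts (phaseMeasure G E₀ Eₘ) := by
  unfold phaseMeasure; infer_instance

theorem phaseMeasure_eq_restrict (G : Set V3) (E₀ Eₘ : ℝ) :
    phaseMeasure G E₀ Eₘ = (fullMeasure E₀ Eₘ).restrict (G ×ˢ univ) := by
  rw [phaseMeasure, fullMeasure, ← Measure.prod_restrict, Measure.restrict_univ]

theorem isOpen_phaseInterior {G : Set V3} (hG : IsOpen G) (E₀ Eₘ : ℝ) :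
    IsOpen (phaseInterior G E₀ Eₘ) :=
  (hG.preimage continuous_fst).inter (isOpen_Ioo.preimage (continuous_snd.comp continuous_snd))

theorem ae_mem_phaseInterior {G : Set V3} (hG : MeasurableSet G) (E₀ Eₘ : ℝ) :
    ∀ᵐ z ∂(phaseMeasure G E₀ Eₘ), z ∈ phaseInterior G E₀ Eₘ := by
  have hfst : ∀ᵐ z ∂(phaseMeasure G E₀ Eₘ), z.1 ∈ G :=
    Measure.quasiMeasurePreserving_fst.ae (ae_restrict_mem hG)
  have hsnd : ∀ᵐ z ∂(phaseMeasure G E₀ Eₘ), z.2.2 ∈ Ioo E₀ Eₘ := by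
    refine (Measure.quasiMeasurePreserving_snd.comp Measure.quasiMeasurePreserving_snd).ae ?_
    rw [← restrict_Ioo_eq_restrict_Icc]
    exact ae_restrict_mem measurableSet_Ioo
  filter_upwards [hfst, hsnd] with z hz₁ hz₂ using ⟨hz₁, hz₂⟩

/-- Translation by `-h v(ω, E)` in the space variable. -/
def shift (v : Sph × ℝ → V3) (h : ℝ) (z : Phase) : Phase := (z.1 - h • v z.2, z.2)

theorem shift_shift (v : Sph × ℝ → V3) (h h' : ℝ) (z : Phase) :
    shift v h (shift v h' z) = shift v (h + h') z := by
  simp only [shift, Prod.mk.injEq, and_true]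
  module

theorem shift_zero (v : Sph × ℝ → V3) (z : Phase) : shift v 0 z = z := by simp [shift]

theorem continuous_uncurry_shift {v : Sph × ℝ → V3} (hv : Continuous v) :
    Continuous fun q : ℝ × Phase => shift v q.1 q.2 := by
  unfold shift; fun_prop

theorem continuous_shift {v : Sph × ℝ → V3} (hv : Continuous v) (h : ℝ) :
    Continuous (shift v h) :=
  (continuous_uncurry_shift hv).comp (Continuous.prodMk_right h)

theorem measurePreserving_shift {v : Sph × ℝ → V3} (hv : Continuous v) (h E₀ Eₘ : ℝ) :
    MeasurePreserving (shift v h) (fullMeasure E₀ Eₘ) (fullMeasure E₀ Eₘ) := by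
  let μ := (volume : Measure V3).toSphere.prod ((volume : Measure ℝ).restrict (Icc E₀ Eₘ))
  have hcont : Continuous (Function.uncurry fun (p : Sph × ℝ) (x : V3) => x - h • v p) := by
    fun_prop
  have hskew : MeasurePreserving (fun q : (Sph × ℝ) × V3 => (q.1, q.2 - h • v q.1))
      (μ.prod volume) (μ.prod volume) :=
    (MeasurePreserving.id μ).skew_product (g := fun p x => x - h • v p) hcont.measurable
      (.of_forall fun p => (measurePreserving_sub_right volume (h • v p)).map_eq)
  have hswap : MeasurePreserving Prod.swap (μ.prod (volume : Measure V3)) (volume.prod μ) :=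
    Measure.measurePreserving_swap
  exact hswap.comp (hskew.comp Measure.measurePreserving_swap)

theorem integral_comp_shift {v : Sph × ℝ → V3} (hv : Continuous v) (h E₀ Eₘ : ℝ)
    (f : Phase → ℝ) :
    ∫ z, f (shift v h z) ∂(fullMeasure E₀ Eₘ) = ∫ z, f z ∂(fullMeasure E₀ Eₘ) := by
  let e : Phase ≃ₜ Phase :=
    { toFun := shift v h
      invFun := shift v (-h)
      left_inv := fun z => by rw [shift_shift, neg_add_cancel, shift_zero]
      right_inv := fun z => by rw [shift_shift, add_neg_cancel, shift_zero]
      continuous_toFun := continuous_shift hv h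
      continuous_invFun := continuous_shift hv (-h) }
  exact (measurePreserving_shift hv h E₀ Eₘ).integral_comp e.measurableEmbedding f

theorem IsCx.hasDerivAt_shift {f : Phase → ℝ} (hf : IsCx 1 f) (v : Sph × ℝ → V3) (z : Phase)
    (h : ℝ) : HasDerivAt (fun h => f (shift v h z)) (-Transport.dirDeriv v f (shift v h z)) h := by
  have hline : HasDerivAt (fun h : ℝ => z.1 - h • v z.2) (-((1 : ℝ) • v z.2)) h :=
    ((hasDerivAt_id h).smul_const (v z.2)).const_sub z.1
  convert! (hf.hasFDerivAt (z.1 - h • v z.2) z.2).comp_hasDerivAt h hline using 1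
  simp [Transport.dirDeriv, shift]

theorem exists_integrable_bound_comp_shift (ν : Measure Phase) [IsFiniteMeasureOnCompacts ν]
    {v : Sph × ℝ → V3} (hv : Continuous v) {g : Phase → ℝ} (hg : Continuous g)
    (hgc : HasCompactSupport g) :
    ∃ b : Phase → ℝ, Integrable b ν ∧
      ∀ z, ∀ h ∈ Metric.ball (0 : ℝ) 1, ‖g (shift v h z)‖ ≤ b z := by
  obtain ⟨M, hM⟩ := hgc.exists_bound_of_continuous hg
  let K := (fun q : ℝ × Phase => shift v q.1 q.2) '' (Icc (-1) 1 ×ˢ tsupport g)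
  have hK : IsCompact K := (isCompact_Icc.prod hgc).image (continuous_uncurry_shift hv)
  refine ⟨K.indicator fun _ => M, (integrable_indicator_iff hK.measurableSet).2
    (integrableOn_const hK.measure_lt_top.ne), fun z h hh => ?_⟩
  by_cases hz : shift v h z ∈ tsupport g
  · rw [mem_ball_zero_iff, Real.norm_eq_abs, abs_lt] at hh
    have hzK : z ∈ K := ⟨(-h, shift v h z), ⟨⟨by linarith, by linarith⟩, hz⟩, by
      simp only [shift_shift, neg_add_cancel, shift_zero]⟩
    rw [indicator_of_mem hzK]
    exact hM _
  · rw [image_eq_zero_of_notMem_tsupport hz, norm_zero]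
    exact indicator_nonneg (fun _ _ => (norm_nonneg _).trans (hM z)) _

theorem hasDerivAt_integral_shift (ν : Measure Phase) [IsFiniteMeasureOnCompacts ν]
    {v : Sph × ℝ → V3} (hv : Continuous v) {f : Phase → ℝ} (hf : IsCxCompact 1 f) :
    HasDerivAt (fun h => ∫ z, f (shift v h z) ∂ν) (-∫ z, dirDeriv v f z ∂ν) 0 := by
  have hD : IsCxCompact 0 (dirDeriv v f) := hf.dirDeriv hv
  obtain ⟨b, hb, hle⟩ := exists_integrable_bound_comp_shift ν hv hD.1.continuous hD.2
  have key := hasDerivAt_integral_of_dominated_loc_of_deriv_le (μ := ν)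
    (F := fun h z => f (shift v h z)) (F' := fun h z => -dirDeriv v f (shift v h z))
    (x₀ := (0 : ℝ)) (bound := b) (Metric.ball_mem_nhds _ one_pos)
    (.of_forall fun h => (hf.1.continuous.comp (continuous_shift hv h)).aestronglyMeasurable)
    (by simpa only [shift_zero] using hf.integrable)
    (by simpa only [shift_zero] using hD.1.continuous.fun_neg.aestronglyMeasurable)
    (.of_forall fun z h hh => by simpa only [norm_neg] using hle z h hh) hb
    (.of_forall fun z h _ => hf.1.hasDerivAt_shift v z h)
  simpa only [shift_zero, integral_neg] using key.2

theorem integral_dirDeriv_eq_zero (E₀ Eₘ : ℝ) {v : Sph × ℝ → V3} (hv : Continuous v)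
    {f : Phase → ℝ} (hf : IsCxCompact 1 f) : ∫ z, dirDeriv v f z ∂(fullMeasure E₀ Eₘ) = 0 := by
  have hder := hasDerivAt_integral_shift (fullMeasure E₀ Eₘ) hv hf
  simp only [integral_comp_shift hv] at hder
  exact neg_eq_zero.1 (hder.unique (hasDerivAt_const _ _))

/-! ### Green's formula -/

/-- The support of a function on `G × S × I`, as a subset of the closed phase space. -/
def phaseSupport (G : Set V3) (E₀ Eₘ : ℝ) (ψ : Phase → ℝ) : Set Phase :=
  closure (Function.support ψ ∩ phaseInterior G E₀ Eₘ)

theorem phaseSupport_subset {G : Set V3} {E₀ Eₘ : ℝ} {ψ : Phase → ℝ} :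
    phaseSupport G E₀ Eₘ ψ ⊆ closure G ×ˢ (univ ×ˢ Icc E₀ Eₘ) := by
  refine closure_minimal ?_ (isClosed_closure.prod (isClosed_univ.prod isClosed_Icc))
  rintro z ⟨-, hz₁, hz₂⟩
  exact ⟨subset_closure hz₁, mem_univ _, Ioo_subset_Icc_self hz₂⟩

theorem phaseSupport_subset_tsupport {G : Set V3} {E₀ Eₘ : ℝ} {ψ : Phase → ℝ} :
    phaseSupport G E₀ Eₘ ψ ⊆ tsupport ψ :=
  closure_mono inter_subset_left

theorem isCompact_phaseSupport {G : Set V3} (hG : Bornology.IsBounded G) {E₀ Eₘ : ℝ}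
    {ψ : Phase → ℝ} : IsCompact (phaseSupport G E₀ Eₘ ψ) :=
  (hG.isCompact_closure.prod (isCompact_univ.prod isCompact_Icc)).of_isClosed_subset
    isClosed_closure phaseSupport_subset

theorem apply_eq_zero_of_notMem_phaseSupport {G : Set V3} {E₀ Eₘ : ℝ} {ψ : Phase → ℝ} {z : Phase}
    (hz : z ∈ phaseInterior G E₀ Eₘ) (hψ : z ∉ phaseSupport G E₀ Eₘ ψ) : ψ z = 0 :=
  not_not.1 fun h => hψ (subset_closure ⟨h, hz⟩)

theorem phaseSupport_congr {G : Set V3} {E₀ Eₘ : ℝ} {ψ φ : Phase → ℝ}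
    (h : EqOn ψ φ (phaseInterior G E₀ Eₘ)) :
    phaseSupport G E₀ Eₘ ψ = phaseSupport G E₀ Eₘ φ := by
  unfold phaseSupport
  congr 1
  ext z
  simp only [mem_inter_iff, Function.mem_support]
  exact and_congr_left fun hz => by rw [h hz]

theorem phaseSupport_mul_left_subset {G : Set V3} {E₀ Eₘ : ℝ} {ψ φ : Phase → ℝ} :
    phaseSupport G E₀ Eₘ (fun z => ψ z * φ z) ⊆ phaseSupport G E₀ Eₘ φ :=
  closure_mono (inter_subset_inter_left _ (Function.support_mul_subset_right _ _))

theorem phaseSupport_mul_right_subset {G : Set V3} {E₀ Eₘ : ℝ} {ψ φ : Phase → ℝ} :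
    phaseSupport G E₀ Eₘ (fun z => ψ z * φ z) ⊆ phaseSupport G E₀ Eₘ ψ :=
  closure_mono (inter_subset_inter_left _ (Function.support_mul_subset_left _ _))

theorem integral_dirDeriv_phaseMeasure_eq_zero {G : Set V3} (hG : IsOpen G) {E₀ Eₘ : ℝ}
    {v : Sph × ℝ → V3} (hv : Continuous v) {f : Phase → ℝ} (hf : IsCxCompact 1 f)
    (hsupp : phaseSupport G E₀ Eₘ f ⊆ Prod.fst ⁻¹' G) :
    ∫ z, dirDeriv v f z ∂(phaseMeasure G E₀ Eₘ) = 0 := by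
  obtain ⟨χ, hχ, hχ1, hχG⟩ := exists_cutoff isClosed_closure (hG.preimage continuous_fst) hsupp
  have hfχ : EqOn f (fun z => χ z * f z) (phaseInterior G E₀ Eₘ) := fun z hz => by
    by_cases hzs : z ∈ phaseSupport G E₀ Eₘ f
    · simp [hχ1 z hzs]
    · simp [apply_eq_zero_of_notMem_phaseSupport hz hzs]
  have hzero (z : Phase) (hz : z ∉ G ×ˢ univ) : dirDeriv v (fun z => χ z * f z) z = 0 :=
    dirDeriv_eq_zero_of_notMem_tsupport v fun h =>
      hz ⟨hχG (tsupport_mul_subset_left h), mem_univ _⟩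
  calc ∫ z, dirDeriv v f z ∂(phaseMeasure G E₀ Eₘ)
      = ∫ z, dirDeriv v (fun z => χ z * f z) z ∂(phaseMeasure G E₀ Eₘ) :=
        integral_congr_ae ((ae_mem_phaseInterior hG.measurableSet E₀ Eₘ).mono fun _ hz =>
          dirDeriv_congr (isOpen_phaseInterior hG E₀ Eₘ) hfχ v hz)
    _ = ∫ z, dirDeriv v (fun z => χ z * f z) z ∂(fullMeasure E₀ Eₘ) := by
        rw [phaseMeasure_eq_restrict]
        exact setIntegral_eq_integral_of_forall_compl_eq_zero hzero
    _ = 0 := integral_dirDeriv_eq_zero E₀ Eₘ hv (.mul_left (hχ 1) hf)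

theorem integral_dirDeriv_mul {G : Set V3} (hG : IsOpen G) {E₀ Eₘ : ℝ}
    {v : Sph × ℝ → V3} (hv : Continuous v) {f φ ψ : Phase → ℝ} (hf : IsCx 1 f)
    (hψ : EqOn ψ f (phaseInterior G E₀ Eₘ)) (hφ : IsCxCompact 1 φ)
    (hsupp : phaseSupport G E₀ Eₘ (fun z => ψ z * φ z) ⊆ Prod.fst ⁻¹' G) :
    ∫ z, dirDeriv v ψ z * φ z ∂(phaseMeasure G E₀ Eₘ) =
      -∫ z, ψ z * dirDeriv v φ z ∂(phaseMeasure G E₀ Eₘ) := by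
  rw [phaseSupport_congr (φ := fun z => f z * φ z) fun z hz => by simp only [hψ hz]] at hsupp
  have hae := ae_mem_phaseInterior hG.measurableSet E₀ Eₘ
  have hψf : ∫ z, dirDeriv v ψ z * φ z ∂(phaseMeasure G E₀ Eₘ) =
      ∫ z, dirDeriv v f z * φ z ∂(phaseMeasure G E₀ Eₘ) :=
    integral_congr_ae (hae.mono fun z hz => by
      simp only [dirDeriv_congr (isOpen_phaseInterior hG E₀ Eₘ) hψ v hz])
  have hψf' : ∫ z, ψ z * dirDeriv v φ z ∂(phaseMeasure G E₀ Eₘ) =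
      ∫ z, f z * dirDeriv v φ z ∂(phaseMeasure G E₀ Eₘ) :=
    integral_congr_ae (hae.mono fun z hz => by simp only [hψ hz])
  have hint := integral_dirDeriv_phaseMeasure_eq_zero hG hv (hφ.mul_left hf) hsupp
  have hint₁ : Integrable (fun z => dirDeriv v f z * φ z) (phaseMeasure G E₀ Eₘ) :=
    ((hφ.mono zero_le_one).mul_left (hf.dirDeriv hv)).integrable
  have hint₂ : Integrable (fun z => f z * dirDeriv v φ z) (phaseMeasure G E₀ Eₘ) :=
    ((hφ.dirDeriv hv).mul_left (hf.mono zero_le_one)).integrable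
  simp only [dirDeriv_mul v hf hφ.1] at hint
  rw [integral_add hint₁ hint₂] at hint
  rw [hψf, hψf', eq_neg_of_add_eq_zero_left hint]

/-! ### Accretivity of the streaming term -/

/-- The points outside of `G` from which the forward characteristic enters `G`. -/
def backwardShadow (G : Set V3) : Set Phase :=
  {z | z.1 ∉ G ∧ ∃ t : ℝ, 0 ≤ t ∧ z.1 + t • (z.2.1 : V3) ∈ G}

theorem integral_comp_shift_direction_le {G : Set V3} (hG : MeasurableSet G) {E₀ Eₘ : ℝ}
    {g : Phase → ℝ} (hg : ∀ z, 0 ≤ g z) (hint : Integrable g (fullMeasure E₀ Eₘ))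
    (hshadow : ∀ z ∈ backwardShadow G, g z = 0) {h : ℝ} (hh : 0 ≤ h) :
    ∫ z, g (shift direction h z) ∂(phaseMeasure G E₀ Eₘ) ≤ ∫ z, g z ∂(phaseMeasure G E₀ Eₘ) := by
  have hm : MeasurableSet (G ×ˢ (univ : Set (Sph × ℝ))) := hG.prod .univ
  rw [phaseMeasure_eq_restrict, ← integral_indicator hm, ← integral_indicator hm,
    ← integral_comp_shift continuous_direction h E₀ Eₘ ((G ×ˢ univ).indicator g)]
  refine integral_mono_of_nonneg
    (.of_forall fun z => indicator_nonneg (fun z _ => hg _) z)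
    ((measurePreserving_shift continuous_direction h E₀ Eₘ).integrable_comp_of_integrable
      (hint.indicator hm)) (.of_forall fun z => ?_)
  by_cases hz : z.1 ∈ G
  · by_cases hz' : (shift direction h z).1 ∈ G
    · simp [hz, hz']
    · have hzero : g (shift direction h z) = 0 :=
        hshadow _ ⟨hz', h, hh, by simpa [shift, direction] using hz⟩
      simp [hz, hz', hzero]
  · simpa [hz] using indicator_nonneg (fun z _ => hg z) _

theorem integral_mul_advect_nonneg {G : Set V3} (hG : MeasurableSet G) (E₀ Eₘ : ℝ)
    {f : Phase → ℝ} (hf : IsCxCompact 1 f) (hshadow : ∀ z ∈ backwardShadow G, f z = 0) :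
    0 ≤ ∫ z, f z * advect f z ∂(phaseMeasure G E₀ Eₘ) := by
  have hsq : IsCxCompact 1 (fun z => f z * f z) := hf.mul_left hf.1
  have hder := hasDerivAt_integral_shift (phaseMeasure G E₀ Eₘ) continuous_direction hsq
  have hle := nonpos_of_hasDerivAt_of_eventually_le hder (by
    filter_upwards [self_mem_nhdsWithin] with h hh
    simp only [shift_zero]
    exact integral_comp_shift_direction_le hG (fun z => mul_self_nonneg (f z)) hsq.integrable
      (fun z hz => by rw [hshadow z hz, mul_zero]) (mem_Ioi.1 hh).le)
  have hsq_deriv (z : Phase) :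
      dirDeriv direction (fun z => f z * f z) z = 2 * (f z * advect f z) := by
    rw [dirDeriv_mul direction hf.1 hf.1, dirDeriv_direction]; ring
  simp only [hsq_deriv, integral_const_mul] at hle
  linarith

/-! ### Geometry of the domain -/

/-- `G` is open and bounded with a `C^∞` boundary, and its closure is convex. -/
structure IsSmoothConvexDomain (G : Set V3) : Prop where
  isOpen : IsOpen G
  isBounded : Bornology.IsBounded G
  smooth_boundary : ∀ y ∈ frontier G, ∃ ρ : V3 → ℝ, IsLocalDefiningFunction G y ρ
  convex : Convex ℝ (closure G)

theorem IsSmoothStrictlyConvexDomain.isSmoothConvexDomain {G : Set V3}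
    (hG : IsSmoothStrictlyConvexDomain G) : IsSmoothConvexDomain G :=
  ⟨hG.isOpen, hG.isBounded, hG.smooth_boundary, hG.strictConvex.convex⟩

theorem IsLocalDefiningFunction.eventually_nonpos {G : Set V3} {y : V3} {ρ : V3 → ℝ}
    (hρ : IsLocalDefiningFunction G y ρ) : ∀ᶠ x in 𝓝 y, x ∈ closure G → ρ x ≤ 0 := by
  filter_upwards [hρ.2.2.eventually_nhds] with x hx hxG
  refine le_of_tendsto_of_frequently hρ.1.continuous.continuousAt ?_
  exact ((mem_closure_iff_frequently.1 hxG).and_eventually hx).mono fun x' h => (h.2.1 h.1).le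

theorem IsLocalDefiningFunction.apply_eq_zero {G : Set V3} (hG : IsOpen G) {y : V3} {ρ : V3 → ℝ}
    (hρ : IsLocalDefiningFunction G y ρ) (hy : y ∈ frontier G) : ρ y = 0 := by
  rw [hG.frontier_eq] at hy
  refine le_antisymm (hρ.eventually_nonpos.self_of_nhds hy.1) (not_lt.1 fun h => hy.2 ?_)
  exact hρ.2.2.self_of_nhds.2 h

theorem IsOutwardNormal.norm_eq_one {G : Set V3} {y n : V3} (hn : IsOutwardNormal G y n) :
    ‖n‖ = 1 := by
  obtain ⟨ρ, hρ, rfl⟩ := hn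
  exact norm_smul_inv_norm hρ.2.1

theorem IsSmoothConvexDomain.exists_outwardNormal {G : Set V3} (hG : IsSmoothConvexDomain G)
    {y : V3} (hy : y ∈ frontier G) : ∃ n, IsOutwardNormal G y n := by
  obtain ⟨ρ, hρ⟩ := hG.smooth_boundary y hy
  exact ⟨_, ρ, hρ, rfl⟩

theorem IsOutwardNormal.exists_sub_smul_mem {G : Set V3} (hG : IsOpen G) {y n θ : V3}
    (hn : IsOutwardNormal G y n) (hy : y ∈ frontier G) (hθ : 0 < inner ℝ n θ) :
    ∃ s : ℝ, 0 < s ∧ y - s • θ ∈ G := by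
  obtain ⟨ρ, hρ, rfl⟩ := hn
  by_contra! hout
  have hgrad : 0 < inner ℝ (gradient ρ y) θ := by
    rw [real_inner_smul_left] at hθ
    exact pos_of_mul_pos_right hθ (by positivity)
  have hderiv : HasDerivAt (fun s : ℝ => -ρ (y + s • -θ)) (inner ℝ (gradient ρ y) θ) 0 := by
    have hline := (((hρ.1.differentiable (by simp)) y).hasGradientAt.hasFDerivAt.hasLineDerivAt
      (-θ)).fun_neg
    simpa [HasLineDerivAt] using hline
  refine hgrad.not_ge (nonpos_of_hasDerivAt_of_eventually_le hderiv ?_)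
  have hcont : Tendsto (fun s : ℝ => y + s • -θ) (𝓝[>] 0) (𝓝 y) := by
    have : Continuous fun s : ℝ => y + s • -θ := by fun_prop
    simpa using (this.tendsto 0).mono_left nhdsWithin_le_nhds
  filter_upwards [self_mem_nhdsWithin, hcont.eventually hρ.2.2] with s hs hiff
  have hmem : y + s • -θ ∉ G := by simpa [sub_eq_add_neg] using hout s hs
  simpa [hρ.apply_eq_zero hG hy] using hiff.not.1 hmem

section SupportingPlane

variable {G : Set V3} (hG : IsOpen G) (hconv : Convex ℝ (closure G)) {y n : V3}
  (hn : IsOutwardNormal G y n) (hy : y ∈ frontier G)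

include hG hconv hn hy

theorem IsOutwardNormal.inner_sub_nonpos {z : V3} (hz : z ∈ closure G) :
    inner ℝ n (z - y) ≤ 0 := by
  obtain ⟨ρ, hρ, rfl⟩ := hn
  have hderiv : HasDerivAt (fun s : ℝ => ρ (y + s • (z - y)))
      (inner ℝ (gradient ρ y) (z - y)) 0 := by
    simpa [HasLineDerivAt] using
      ((hρ.1.differentiable (by simp)) y).hasGradientAt.hasFDerivAt.hasLineDerivAt (z - y)
  have hcont : Tendsto (fun s : ℝ => y + s • (z - y)) (𝓝[>] 0) (𝓝 y) := by
    have : Continuous fun s : ℝ => y + s • (z - y) := by fun_prop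
    simpa using (this.tendsto 0).mono_left nhdsWithin_le_nhds
  rw [real_inner_smul_left]
  refine mul_nonpos_of_nonneg_of_nonpos (by positivity)
    (nonpos_of_hasDerivAt_of_eventually_le hderiv ?_)
  filter_upwards [Ioo_mem_nhdsGT one_pos, hcont.eventually hρ.eventually_nonpos] with s hs hle
  simpa [hρ.apply_eq_zero hG hy] using
    hle (hconv.add_smul_sub_mem (frontier_subset_closure hy) hz ⟨hs.1.le, hs.2.le⟩)

theorem IsOutwardNormal.inner_sub_neg {z : V3} (hz : z ∈ interior (closure G)) :
    inner ℝ n (z - y) < 0 := by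
  have hnhds : ∀ᶠ s : ℝ in 𝓝[>] 0, z + s • n ∈ closure G := by
    have hcont : ContinuousAt (fun s : ℝ => z + s • n) 0 := by fun_prop
    exact (hcont.eventually (by simpa using mem_interior_iff_mem_nhds.1 hz)).filter_mono
      nhdsWithin_le_nhds
  obtain ⟨s, hs, hs0 : 0 < s⟩ := (hnhds.and self_mem_nhdsWithin).exists
  have hle := hn.inner_sub_nonpos hG hconv hy hs
  rw [add_sub_right_comm, inner_add_right, inner_smul_right, real_inner_self_eq_norm_sq,
    hn.norm_eq_one] at hle
  linarith

end SupportingPlane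

theorem IsSmoothConvexDomain.convex_self {G : Set V3} (hG : IsSmoothConvexDomain G) :
    Convex ℝ G := by
  have hinterior : interior (closure G) = G := by
    refine subset_antisymm (fun y hy => ?_) hG.isOpen.subset_interior_closure
    by_contra hyG
    have hfr : y ∈ frontier G := by
      rw [hG.isOpen.frontier_eq]
      exact ⟨interior_subset hy, hyG⟩
    obtain ⟨n, hn⟩ := hG.exists_outwardNormal hfr
    simpa using hn.inner_sub_neg hG.isOpen hG.convex hfr hy
  exact hinterior ▸ hG.convex.interior

theorem notMem_closure_backwardShadow {G : Set V3} (hG : IsOpen G) (hconv : Convex ℝ G) {z : Phase}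
    {s : ℝ} (hs : 0 ≤ s) (hz : z.1 - s • (z.2.1 : V3) ∈ G) : z ∉ closure (backwardShadow G) := by
  have hopen : IsOpen {z' : Phase | z'.1 - s • (z'.2.1 : V3) ∈ G} := hG.preimage (by fun_prop)
  rw [mem_closure_iff_frequently, not_frequently]
  filter_upwards [hopen.mem_nhds hz] with z' hback
  rintro ⟨hout, t, ht, hfwd⟩
  rcases (add_nonneg hs ht).eq_or_lt with hst | hst
  · obtain rfl : t = 0 := by linarith
    exact hout (by simpa using hfwd)
  · have hmem := hconv hback hfwd (a := t / (s + t)) (b := s / (s + t)) (by positivity)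
      (by positivity) (by field_simp; ring)
    refine hout ?_
    convert! hmem using 1
    match_scalars <;> field_simp <;> ring

theorem IsSmoothConvexDomain.exists_outwardNormal_inner_pos {G : Set V3}
    (hG : IsSmoothConvexDomain G) {E₀ Eₘ : ℝ} {z : Phase} (hz : z ∉ gammaMinusZero G E₀ Eₘ)
    (hfr : z.1 ∈ frontier G) (hE : z.2.2 ∈ Icc E₀ Eₘ) :
    ∃ n, IsOutwardNormal G z.1 n ∧ 0 < inner ℝ n (z.2.1 : V3) := by
  obtain ⟨n, hn⟩ := hG.exists_outwardNormal hfr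
  refine ⟨n, hn, not_le.1 fun hle => hz ⟨hfr, hE, n, hn, ?_⟩⟩
  rwa [real_inner_comm]

theorem IsSmoothConvexDomain.disjoint_closure_backwardShadow {G : Set V3}
    (hG : IsSmoothConvexDomain G) {E₀ Eₘ : ℝ} {ψ : Phase → ℝ}
    (hψ : Disjoint (phaseSupport G E₀ Eₘ ψ) (gammaMinusZero G E₀ Eₘ)) :
    Disjoint (phaseSupport G E₀ Eₘ ψ) (closure (backwardShadow G)) := by
  rw [Set.disjoint_left] at hψ ⊢
  intro z hz
  obtain ⟨hcl, -, hE⟩ := phaseSupport_subset hz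
  by_cases hzG : z.1 ∈ G
  · exact notMem_closure_backwardShadow hG.isOpen hG.convex_self le_rfl (by simpa using hzG)
  · have hfr : z.1 ∈ frontier G := by
      rw [hG.isOpen.frontier_eq]
      exact ⟨hcl, hzG⟩
    obtain ⟨n, hn, hpos⟩ := hG.exists_outwardNormal_inner_pos (hψ hz) hfr hE
    obtain ⟨s, hs, hmem⟩ := hn.exists_sub_smul_mem hG.isOpen hfr hpos
    exact notMem_closure_backwardShadow hG.isOpen hG.convex_self hs.le hmem

theorem IsSmoothConvexDomain.shift_neg_notMem_gammaMinusZero {G : Set V3}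
    (hG : IsSmoothConvexDomain G) {E₀ Eₘ : ℝ} {z : Phase} (hcl : z.1 ∈ closure G)
    (hz : z ∉ gammaMinusZero G E₀ Eₘ) {t : ℝ} (ht : 0 ≤ t) :
    shift direction (-t) z ∉ gammaMinusZero G E₀ Eₘ := by
  rintro ⟨hfr, hE, n, hn, hle⟩
  rcases ht.eq_or_lt with rfl | ht
  · rw [neg_zero, shift_zero] at hfr hE hn hle
    exact hz ⟨hfr, hE, n, hn, hle⟩
  have hflow : (shift direction (-t) z).1 = z.1 + t • (z.2.1 : V3) := by simp [shift, direction]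
  rw [hflow] at hfr hn
  by_cases hzG : z.1 ∈ G
  · have hneg := hn.inner_sub_neg hG.isOpen hG.convex hfr
      (hG.isOpen.subset_interior_closure hzG)
    rw [sub_add_cancel_left, inner_neg_right, inner_smul_right, real_inner_comm] at hneg
    have hpos : 0 < t * inner ℝ (z.2.1 : V3) n := by linarith
    exact (pos_of_mul_pos_right hpos ht.le).not_ge hle
  · have hfr' : z.1 ∈ frontier G := by
      rw [hG.isOpen.frontier_eq]
      exact ⟨hcl, hzG⟩
    obtain ⟨n', hn', hpos⟩ := hG.exists_outwardNormal_inner_pos hz hfr' hE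
    have hnonpos := hn'.inner_sub_nonpos hG.isOpen hG.convex hfr' (frontier_subset_closure hfr)
    rw [add_sub_cancel_left, inner_smul_right] at hnonpos
    exact (mul_pos ht hpos).not_ge hnonpos

theorem IsInflowVanishing.exists_extension {G : Set V3} (hG : IsSmoothConvexDomain G)
    {E₀ Eₘ : ℝ} {k : ℕ} {ψ : Phase → ℝ} (hψ : IsInflowVanishing G E₀ Eₘ k ψ) :
    ∃ f, IsCxCompact k f ∧ EqOn ψ f (phaseInterior G E₀ Eₘ) ∧ ∀ z ∈ backwardShadow G, f z = 0 := by
  obtain ⟨⟨f, hf, hψf⟩, hdisj⟩ := hψ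
  obtain ⟨χ, hχ, hχ1, hχ0⟩ := exists_cutoff isClosed_closure isClosed_closure.isOpen_compl
    (disjoint_left.1 (hG.disjoint_closure_backwardShadow hdisj))
  refine ⟨fun z => χ z * f z, .mul_left (hχ k) hf, fun z hz => ?_, fun z hz => ?_⟩
  · by_cases hzs : z ∈ phaseSupport G E₀ Eₘ ψ
    · simp only [hχ1 z hzs, one_mul, hψf hz]
    · simp only [← hψf hz, apply_eq_zero_of_notMem_phaseSupport hz hzs, mul_zero]
  · simp only [image_eq_zero_of_notMem_tsupport fun h => hχ0 h (subset_closure hz), zero_mul]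

/-! ### The resolvent of the streaming term -/

/-- The solution `∫₀^∞ e^{-Ct} f(x - t v(ω, E), ω, E) dt` of `v · ∇ₓ ψ + C ψ = f`. -/
def resolvent (v : Sph × ℝ → V3) (C : ℝ) (f : Phase → ℝ) : Phase → ℝ := fun z =>
  ∫ t in Ioi (0 : ℝ), Real.exp (-C * t) * f (shift v t z)

theorem continuous_exp_mul_comp_shift {v : Sph × ℝ → V3} (hv : Continuous v) (C : ℝ)
    {f : Phase → ℝ} (hf : Continuous f) (z : Phase) :
    Continuous fun t : ℝ => Real.exp (-C * t) * f (shift v t z) :=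
  (by fun_prop : Continuous fun t : ℝ => Real.exp (-C * t)).mul
    (hf.comp ((continuous_uncurry_shift hv).comp (Continuous.prodMk_left z)))

theorem norm_exp_mul_le {a M : ℝ} (ha : ‖a‖ ≤ M) (C t : ℝ) :
    ‖Real.exp (-C * t) * a‖ ≤ Real.exp (-C * t) * M := by
  rw [norm_mul, Real.norm_eq_abs, Real.abs_exp]
  gcongr

theorem integrableOn_exp_mul_comp_shift {v : Sph × ℝ → V3} (hv : Continuous v) {C : ℝ}
    (hC : 0 < C) {f : Phase → ℝ} (hf : Continuous f) (hfc : HasCompactSupport f) (z : Phase) :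
    IntegrableOn (fun t : ℝ => Real.exp (-C * t) * f (shift v t z)) (Ioi 0) := by
  obtain ⟨M, hM⟩ := hfc.exists_bound_of_continuous hf
  exact ((exp_neg_integrableOn_Ioi 0 hC).mul_const M).mono'
    (continuous_exp_mul_comp_shift hv C hf z).aestronglyMeasurable
    (.of_forall fun t => norm_exp_mul_le (hM _) C t)

theorem continuous_resolvent {v : Sph × ℝ → V3} (hv : Continuous v) {C : ℝ} (hC : 0 < C)
    {f : Phase → ℝ} (hf : Continuous f) (hfc : HasCompactSupport f) :
    Continuous (resolvent v C f) := by
  obtain ⟨M, hM⟩ := hfc.exists_bound_of_continuous hf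
  exact continuous_of_dominated
    (fun z => (continuous_exp_mul_comp_shift hv C hf z).aestronglyMeasurable)
    (fun z => .of_forall fun t => norm_exp_mul_le (hM _) C t)
    ((exp_neg_integrableOn_Ioi 0 hC).mul_const M)
    (.of_forall fun t => continuous_const.mul (hf.comp (continuous_shift hv t)))

theorem hasLineDerivAt_resolvent {v : Sph × ℝ → V3} (hv : Continuous v) {C : ℝ} (hC : 0 < C)
    {f : Phase → ℝ} (hf : IsCxCompact 1 f) (i : Fin 3) (z : Phase) :
    HasLineDerivAt ℝ (fun x => resolvent v C f (x, z.2)) (resolvent v C (pd i f) z) z.1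
      (basisVec i) := by
  have hpd : IsCxCompact 0 (pd i f) := hf.pd i
  obtain ⟨M, hM⟩ := hpd.2.exists_bound_of_continuous hpd.1.continuous
  have hderiv (t s : ℝ) :
      HasDerivAt (fun s : ℝ => Real.exp (-C * t) * f (shift v t (z.1 + s • basisVec i, z.2)))
        (Real.exp (-C * t) * pd i f (shift v t (z.1 + s • basisVec i, z.2))) s := by
    have hline := hf.1.hasDerivAt_shift (fun _ => -basisVec i) (shift v t z) s
    have hcomm (s : ℝ) : shift (fun _ => -basisVec i) s (shift v t z) =
        shift v t (z.1 + s • basisVec i, z.2) := by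
      simp only [shift, Prod.mk.injEq, and_true]
      module
    have hneg (w : Phase) : -dirDeriv (fun _ => -basisVec i) f w = pd i f w := by
      rw [← dirDeriv_basisVec i f]
      simp only [dirDeriv, PiLp.neg_apply, neg_mul, Finset.sum_neg_distrib, neg_neg]
    simp only [hcomm, hneg] at hline
    exact hline.const_mul _
  have key := hasDerivAt_integral_of_dominated_loc_of_deriv_le
    (μ := volume.restrict (Ioi (0 : ℝ)))
    (F := fun s t => Real.exp (-C * t) * f (shift v t (z.1 + s • basisVec i, z.2)))
    (F' := fun s t => Real.exp (-C * t) * pd i f (shift v t (z.1 + s • basisVec i, z.2)))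
    (x₀ := (0 : ℝ)) (s := univ) (bound := fun t => Real.exp (-C * t) * M) univ_mem
    (.of_forall fun s =>
      (continuous_exp_mul_comp_shift hv C hf.1.continuous _).aestronglyMeasurable)
    (integrableOn_exp_mul_comp_shift hv hC hf.1.continuous hf.2 _)
    (continuous_exp_mul_comp_shift hv C hpd.1.continuous _).aestronglyMeasurable
    (.of_forall fun t s _ => norm_exp_mul_le (hM _) C t)
    ((exp_neg_integrableOn_Ioi 0 hC).mul_const M)
    (.of_forall fun t s _ => hderiv t s)
  simpa only [zero_smul, add_zero] using! key.2

theorem pd_resolvent {v : Sph × ℝ → V3} (hv : Continuous v) {C : ℝ} (hC : 0 < C) {f : Phase → ℝ}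
    (hf : IsCxCompact 1 f) (i : Fin 3) : pd i (resolvent v C f) = resolvent v C (pd i f) :=
  funext fun z => (hasLineDerivAt_resolvent hv hC hf i z).lineDeriv

theorem IsCxCompact.resolvent {v : Sph × ℝ → V3} (hv : Continuous v) {C : ℝ} (hC : 0 < C) {k : ℕ}
    {f : Phase → ℝ} (hf : IsCxCompact k f) : IsCx k (resolvent v C f) := by
  induction k generalizing f with
  | zero => exact continuous_resolvent hv hC hf.1 hf.2
  | succ k ih =>
    exact .of_hasLineDerivAt (continuous_resolvent hv hC hf.1.continuous hf.2)
      (fun i x p => hasLineDerivAt_resolvent hv hC (hf.mono (by omega)) i (x, p))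
      (fun i => ih (hf.pd i))

theorem dirDeriv_resolvent {v w : Sph × ℝ → V3} (hv : Continuous v) {C : ℝ} (hC : 0 < C)
    {f : Phase → ℝ} (hf : IsCxCompact 1 f) :
    dirDeriv w (resolvent v C f) = resolvent v C (dirDeriv w f) := by
  ext z
  have hint (i : Fin 3) := integrableOn_exp_mul_comp_shift hv hC
    (hf.pd (k := 0) i).1.continuous (hf.pd (k := 0) i).2 z
  simp only [dirDeriv, pd_resolvent hv hC hf, resolvent, ← integral_const_mul]
  rw [← integral_finsetSum _ fun i _ => (hint i).const_mul _]
  refine integral_congr_ae (.of_forall fun t => ?_)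
  simp only [Finset.mul_sum, shift, mul_left_comm]

theorem resolvent_dirDeriv_add {v : Sph × ℝ → V3} (hv : Continuous v) {C : ℝ} (hC : 0 < C)
    {f : Phase → ℝ} (hf : IsCxCompact 1 f) (z : Phase) :
    resolvent v C (dirDeriv v f) z + C * resolvent v C f z = f z := by
  have hD : IsCxCompact 0 (dirDeriv v f) := hf.dirDeriv hv
  have hint := integrableOn_exp_mul_comp_shift hv hC hf.1.continuous hf.2 z
  have hintD := integrableOn_exp_mul_comp_shift hv hC hD.1.continuous hD.2 z
  have hderiv (t : ℝ) : HasDerivAt (fun t => Real.exp (-C * t) * f (shift v t z))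
      (-(Real.exp (-C * t) * dirDeriv v f (shift v t z) +
        C * (Real.exp (-C * t) * f (shift v t z)))) t := by
    refine (((hasDerivAt_id t).const_mul (-C)).exp.mul (hf.1.hasDerivAt_shift v z t)).congr_deriv ?_
    simp only [id]
    ring
  have hlim : Tendsto (fun t : ℝ => Real.exp (-C * t) * f (shift v t z)) atTop (𝓝 0) := by
    obtain ⟨M, hM⟩ := hf.2.exists_bound_of_continuous hf.1.continuous
    refine squeeze_zero_norm (fun t => norm_exp_mul_le (hM _) C t) ?_
    have hbot : Tendsto (fun t : ℝ => -C * t) atTop atBot :=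
      tendsto_id.const_mul_atTop_of_neg (neg_neg_of_pos hC)
    simpa using (Real.tendsto_exp_atBot.comp hbot).mul_const M
  have hFTC := integral_Ioi_of_hasDerivAt_of_tendsto' (a := 0) (fun t _ => hderiv t)
    (hintD.add (hint.const_mul C)).neg hlim
  rw [integral_neg, integral_add hintD (hint.const_mul C), integral_const_mul] at hFTC
  simpa [resolvent, shift_zero] using neg_injective (hFTC.trans (zero_sub _))

theorem advect_resolvent_add {C : ℝ} (hC : 0 < C) {f : Phase → ℝ} (hf : IsCxCompact 1 f)
    (z : Phase) : advect (resolvent direction C f) z + C * resolvent direction C f z = f z := by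
  rw [← dirDeriv_direction, dirDeriv_resolvent continuous_direction hC hf]
  exact resolvent_dirDeriv_add continuous_direction hC hf z

theorem shift_mem_backwardShadow {G : Set V3} {z : Phase} (hz : z.1 ∈ G) {t : ℝ} (ht : 0 ≤ t)
    (hout : (shift direction t z).1 ∉ G) : shift direction t z ∈ backwardShadow G :=
  ⟨hout, t, ht, by simpa [shift, direction] using hz⟩

theorem resolvent_congr {G : Set V3} {E₀ Eₘ : ℝ} {f g : Phase → ℝ} (C : ℝ)
    (h : EqOn f g (phaseInterior G E₀ Eₘ)) (hf : ∀ z ∈ backwardShadow G, f z = 0)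
    (hg : ∀ z ∈ backwardShadow G, g z = 0) :
    EqOn (resolvent direction C f) (resolvent direction C g) (phaseInterior G E₀ Eₘ) := by
  refine fun z hz => setIntegral_congr_fun measurableSet_Ioi fun t ht => ?_
  by_cases hin : (shift direction t z).1 ∈ G
  · simp only [h (show shift direction t z ∈ phaseInterior G E₀ Eₘ from ⟨hin, hz.2⟩)]
  · have hshadow := shift_mem_backwardShadow hz.1 (mem_Ioi.1 ht).le hin
    simp only [hf _ hshadow, hg _ hshadow]

theorem exists_shift_mem_of_resolvent_ne_zero {G : Set V3} {E₀ Eₘ C : ℝ} {f : Phase → ℝ}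
    (hf : ∀ z ∈ backwardShadow G, f z = 0) {z : Phase} (hz : z ∈ phaseInterior G E₀ Eₘ)
    (hne : resolvent direction C f z ≠ 0) :
    ∃ t : ℝ, 0 ≤ t ∧ shift direction t z ∈ Function.support f ∩ phaseInterior G E₀ Eₘ := by
  obtain ⟨t, ht, hft⟩ : ∃ t : ℝ, 0 ≤ t ∧ f (shift direction t z) ≠ 0 := by
    by_contra! hzero
    refine hne (setIntegral_eq_zero_of_forall_eq_zero fun t ht => ?_)
    rw [hzero t (mem_Ioi.1 ht).le, mul_zero]
  refine ⟨t, ht, hft, ?_, hz.2⟩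
  by_contra hout
  exact hft (hf _ (shift_mem_backwardShadow hz.1 ht hout))

theorem phaseSupport_resolvent_subset {G : Set V3} (hG : Bornology.IsBounded G) {E₀ Eₘ C : ℝ}
    {f : Phase → ℝ} (hf : ∀ z ∈ backwardShadow G, f z = 0) :
    ∀ z ∈ phaseSupport G E₀ Eₘ (resolvent direction C f),
      ∃ t : ℝ, 0 ≤ t ∧ ∃ z' ∈ phaseSupport G E₀ Eₘ f, z = shift direction (-t) z' := by
  obtain ⟨R, hR⟩ := Metric.isBounded_iff.1 hG
  let K : Set Phase := (fun q : ℝ × Phase => shift direction (-q.1) q.2) ''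
    (Icc 0 R ×ˢ phaseSupport G E₀ Eₘ f)
  have hK : IsClosed K := ((isCompact_Icc.prod (isCompact_phaseSupport hG)).image
    ((continuous_uncurry_shift continuous_direction).comp
      (by fun_prop : Continuous fun q : ℝ × Phase => (-q.1, q.2)))).isClosed
  have hsub : phaseSupport G E₀ Eₘ (resolvent direction C f) ⊆ K := by
    refine closure_minimal ?_ hK
    rintro z ⟨hne, hz⟩
    obtain ⟨t, ht, hmem⟩ := exists_shift_mem_of_resolvent_ne_zero hf hz hne
    have hdist := hR hz.1 hmem.2.1
    rw [dist_eq_norm, shift, sub_sub_cancel, norm_smul, direction, norm_eq_of_mem_sphere, mul_one,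
      Real.norm_of_nonneg ht] at hdist
    exact ⟨(t, shift direction t z), ⟨⟨ht, hdist⟩, subset_closure hmem⟩, by
      simp only [shift_shift, neg_add_cancel, shift_zero]⟩
  intro z hz
  obtain ⟨⟨t, z'⟩, ⟨ht, hz'⟩, rfl⟩ := hsub hz
  exact ⟨t, ht.1, z', hz', rfl⟩

theorem exists_mem_smoothSpace_advect_add_eq {G : Set V3} (hG : IsSmoothConvexDomain G)
    {E₀ Eₘ : ℝ} {C : ℝ} (hC : 0 < C) {f : Phase → ℝ} (hf : f ∈ smoothSpace G E₀ Eₘ) :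
    ∃ ψ ∈ smoothSpace G E₀ Eₘ,
      EqOn (fun z => advect ψ z + C * ψ z) f (phaseInterior G E₀ Eₘ) := by
  choose! F hF hfF hF0 using fun k (hk : 1 ≤ k) => (hf k hk).exists_extension hG
  obtain ⟨χ, hχ, hχ1⟩ := exists_compact_cutoff
    (hG.isBounded.isCompact_closure.prod ((isCompact_univ (X := Sph)).prod
      (isCompact_Icc (a := E₀) (b := Eₘ))))
  refine ⟨resolvent direction C (F 1), fun k hk => ⟨⟨fun z => resolvent direction C (F k) z * χ z,
    .mul_left ((hF k hk).resolvent continuous_direction hC) (hχ k), fun z hz => ?_⟩, ?_⟩,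
    fun z hz => (advect_resolvent_add hC (hF 1 le_rfl) z).trans (hfF 1 le_rfl hz).symm⟩
  · simp only [hχ1 z ⟨subset_closure hz.1, mem_univ _, Ioo_subset_Icc_self hz.2⟩, mul_one]
    exact resolvent_congr C (fun z hz => (hfF 1 le_rfl hz).symm.trans (hfF k hk hz))
      (hF0 1 le_rfl) (hF0 k hk) hz
  · refine disjoint_left.2 fun z hz => ?_
    obtain ⟨t, ht, z', hz', rfl⟩ := phaseSupport_resolvent_subset hG.isBounded (hF0 1 le_rfl) z hz
    rw [← phaseSupport_congr (hfF 1 le_rfl)] at hz'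
    exact hG.shift_neg_notMem_gammaMinusZero (phaseSupport_subset hz').1
      (disjoint_left.1 (hf 1 le_rfl).2 hz') ht

/-! ### Iterated derivatives of products -/

theorem derivation_pow_mul {R A : Type*} [CommSemiring R] [CommSemiring A] [Algebra R A]
    (D : Derivation R A A) (n : ℕ) (a b : A) :
    ((D : A →ₗ[R] A) ^ n) (a * b) = ∑ p ∈ Finset.HasAntidiagonal.antidiagonal n,
      n.choose p.1 • (((D : A →ₗ[R] A) ^ p.1) a * ((D : A →ₗ[R] A) ^ p.2) b) := by
  induction n with
  | zero => simp
  | succ n ih =>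
    have hD (k l : ℕ) : D (((D : A →ₗ[R] A) ^ k) a * ((D : A →ₗ[R] A) ^ l) b) =
        ((D : A →ₗ[R] A) ^ k) a * ((D : A →ₗ[R] A) ^ (l + 1)) b +
          ((D : A →ₗ[R] A) ^ (k + 1)) a * ((D : A →ₗ[R] A) ^ l) b := by
      rw [D.leibniz, smul_eq_mul, smul_eq_mul, mul_comm (((D : A →ₗ[R] A) ^ l) b)]
      simp only [pow_succ', Module.End.mul_apply, Derivation.coeFn_coe]
    rw [pow_succ', Module.End.mul_apply, ih, map_sum]
    simp only [map_nsmul, Derivation.coeFn_coe, hD, smul_add, Finset.sum_add_distrib]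
    rw [Finset.sum_antidiagonal_choose_succ_nsmul
      (f := fun k l => ((D : A →ₗ[R] A) ^ k) a * ((D : A →ₗ[R] A) ^ l) b) n]
    congr 1
    refine Finset.sum_congr rfl fun p hp => ?_
    rw [Nat.choose_symm_of_eq_add (Finset.HasAntidiagonal.mem_antidiagonal.1 hp).symm]

theorem derivation_pow_mul_of_le {R A : Type*} [CommSemiring R] [CommSemiring A] [Algebra R A]
    (D : Derivation R A A) {n N : ℕ} (hN : n ≤ N) (a b : A) :
    ((D : A →ₗ[R] A) ^ n) (a * b) = ∑ k : Fin (N + 1),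
      n.choose k • (((D : A →ₗ[R] A) ^ (k : ℕ)) a * ((D : A →ₗ[R] A) ^ (n - k)) b) := by
  rw [derivation_pow_mul, Finset.Nat.sum_antidiagonal_eq_sum_range_succ_mk,
    Fin.sum_univ_eq_sum_range fun k =>
      n.choose k • (((D : A →ₗ[R] A) ^ k) a * ((D : A →ₗ[R] A) ^ (n - k)) b)]
  refine Finset.sum_subset (Finset.range_mono (by omega)) fun k _ hk => ?_
  rw [Nat.choose_eq_zero_of_lt (by simpa using hk), zero_smul]

/-- The algebra of smooth functions on three-space. -/
def smoothSubalgebra : Subalgebra ℝ (V3 → ℝ) where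
  carrier := {g | ContDiff ℝ ∞ g}
  mul_mem' := fun {f g} (hf : ContDiff ℝ ∞ f) (hg : ContDiff ℝ ∞ g) => hf.mul hg
  add_mem' := fun {f g} (hf : ContDiff ℝ ∞ f) (hg : ContDiff ℝ ∞ g) => hf.add hg
  algebraMap_mem' := fun c => (contDiff_const : ContDiff ℝ ∞ fun _ : V3 => c)

/-- Smooth functions on three-space, on which the partial derivatives are commuting
derivations. -/
abbrev SmoothFn : Type := smoothSubalgebra

namespace SmoothFn

theorem contDiff (g : SmoothFn) : ContDiff ℝ ∞ (g : V3 → ℝ) := g.2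

theorem differentiableAt (g : SmoothFn) (x : V3) : DifferentiableAt ℝ (g : V3 → ℝ) x :=
  g.contDiff.differentiable (by simp) x

/-- The partial derivative `∂/∂xᵢ` as a derivation. -/
def partialDeriv (i : Fin 3) : Derivation ℝ SmoothFn SmoothFn :=
  Derivation.mk'
    { toFun g := ⟨fun x => fderiv ℝ (g : V3 → ℝ) x (basisVec i),
        (g.contDiff.fderiv_right (m := ∞) (by simp)).clm_apply contDiff_const⟩
      map_add' f g := Subtype.ext <| funext fun x =>
        DFunLike.congr_fun (fderiv_add (f.differentiableAt x) (g.differentiableAt x)) _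
      map_smul' c g := Subtype.ext <| funext fun x =>
        DFunLike.congr_fun (fderiv_const_smul (g.differentiableAt x) c) _ }
    fun f g => Subtype.ext <| funext fun x =>
      DFunLike.congr_fun (fderiv_mul (f.differentiableAt x) (g.differentiableAt x)) _

theorem lineDeriv_eq (i : Fin 3) (g : SmoothFn) (x : V3) :
    lineDeriv ℝ (g : V3 → ℝ) x (basisVec i) = (partialDeriv i g : V3 → ℝ) x :=
  (g.differentiableAt x).lineDeriv_eq_fderiv

theorem commute_partialDeriv (i j : Fin 3) :
    Commute (partialDeriv i : Module.End ℝ SmoothFn) (partialDeriv j : Module.End ℝ SmoothFn) :=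
  LinearMap.ext fun g => Subtype.ext <| funext fun x => by
    have hd : DifferentiableAt ℝ (fderiv ℝ (g : V3 → ℝ)) x :=
      (g.contDiff.fderiv_right (m := ∞) (by simp)).differentiable (by simp) x
    have hsymm : IsSymmSndFDerivAt ℝ (g : V3 → ℝ) x :=
      g.contDiff.contDiffAt.isSymmSndFDerivAt
        (by rw [minSmoothness_of_isRCLikeNormedField]; exact WithTop.coe_le_coe.2 le_top)
    have hsnd (i j) : fderiv ℝ (fun y => fderiv ℝ (g : V3 → ℝ) y (basisVec i)) x (basisVec j) =
        fderiv ℝ (fderiv ℝ (g : V3 → ℝ)) x (basisVec j) (basisVec i) := by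
      rw [fderiv_clm_apply hd (differentiableAt_const _)]
      simp
    exact (hsnd j i).trans ((hsymm.eq _ _).trans (hsnd i j).symm)

/-- The derivative `∂ₓ^a` as a linear map. -/
def multiDeriv (a : Fin 3 → ℕ) : Module.End ℝ SmoothFn :=
  (partialDeriv 0 : Module.End ℝ SmoothFn) ^ a 0 *
    ((partialDeriv 1 : Module.End ℝ SmoothFn) ^ a 1 *
      (partialDeriv 2 : Module.End ℝ SmoothFn) ^ a 2)

theorem multiDeriv_partialDeriv (a : Fin 3 → ℕ) (i : Fin 3) (g : SmoothFn) :
    multiDeriv a (partialDeriv i g) = partialDeriv i (multiDeriv a g) := by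
  have h : Commute (multiDeriv a) (partialDeriv i : Module.End ℝ SmoothFn) :=
    ((commute_partialDeriv 0 i).pow_left _).mul_left
      (((commute_partialDeriv 1 i).pow_left _).mul_left ((commute_partialDeriv 2 i).pow_left _))
  exact LinearMap.congr_fun h.eq g

theorem multiDeriv_mul {a : Fin 3 → ℕ} {N : ℕ} (hN : ∀ i, a i ≤ N) (f g : SmoothFn) :
    multiDeriv a (f * g) = ∑ b : Fin 3 → Fin (N + 1), (∏ i, (a i).choose (b i)) •
      (multiDeriv (fun i => b i) f * multiDeriv (fun i => a i - b i) g) := by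
  let e : (Fin 3 → Fin (N + 1)) ≃ Fin (N + 1) × Fin (N + 1) × Fin (N + 1) :=
    { toFun := fun b => (b 2, b 1, b 0)
      invFun := fun q => ![q.2.2, q.2.1, q.1]
      left_inv := fun b => by ext i; fin_cases i <;> rfl
      right_inv := fun q => rfl }
  rw [← e.symm.sum_comp]
  simp only [Fintype.sum_prod_type, multiDeriv, Module.End.mul_apply,
    derivation_pow_mul_of_le _ (hN _), map_sum, map_nsmul, Finset.smul_sum, smul_smul]
  refine Finset.sum_congr rfl fun k _ => Finset.sum_congr rfl fun l _ =>
    Finset.sum_congr rfl fun j _ => ?_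
  have hcoeff : ∏ i, (a i).choose (e.symm (k, l, j) i) =
      (a 2).choose k * (a 1).choose l * (a 0).choose j := by
    rw [Fin.prod_univ_three]
    change (a 0).choose j * (a 1).choose l * (a 2).choose k = _
    ring
  rw [hcoeff]
  rfl

end SmoothFn

/-- Near `z`, the function `f` agrees with the smooth function `g` of the space variable, the
other variables being fixed. -/
def HasGerm (f : Phase → ℝ) (z : Phase) (g : SmoothFn) : Prop :=
  (fun x => f (x, z.2)) =ᶠ[𝓝 z.1] (g : V3 → ℝ)

namespace HasGerm

variable {f f' : Phase → ℝ} {z : Phase} {g g' : SmoothFn}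

theorem eq (h : HasGerm f z g) : f z = (g : V3 → ℝ) z.1 := h.self_of_nhds

theorem pd (h : HasGerm f z g) (i : Fin 3) : HasGerm (pd i f) z (SmoothFn.partialDeriv i g) :=
  h.eventually_nhds.mono fun x hx => by
    rw [← SmoothFn.lineDeriv_eq]
    exact Filter.EventuallyEq.lineDeriv_eq hx

theorem pd_iterate (h : HasGerm f z g) (i : Fin 3) (n : ℕ) : HasGerm ((Transport.pd i)^[n] f) z
    (((SmoothFn.partialDeriv i : Module.End ℝ SmoothFn) ^ n) g) := by
  induction n with
  | zero => exact h
  | succ n ih =>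
    rw [Function.iterate_succ_apply', pow_succ', Module.End.mul_apply]
    exact ih.pd i

theorem pdMulti (h : HasGerm f z g) (a : Fin 3 → ℕ) :
    HasGerm (pdMulti a f) z (SmoothFn.multiDeriv a g) :=
  ((h.pd_iterate 2 _).pd_iterate 1 _).pd_iterate 0 _

theorem add (h : HasGerm f z g) (h' : HasGerm f' z g') :
    HasGerm (fun z => f z + f' z) z (g + g') :=
  Filter.EventuallyEq.add h h'

theorem mul (h : HasGerm f z g) (h' : HasGerm f' z g') :
    HasGerm (fun z => f z * f' z) z (g * g') :=
  Filter.EventuallyEq.mul h h'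

theorem const_mul (h : HasGerm f z g) (c : ℝ) : HasGerm (fun z => c * f z) z (c • g) :=
  Filter.EventuallyEq.const_smul h c

theorem advect (h : HasGerm f z g) :
    HasGerm (advect f) z (∑ i, (z.2.1 : V3) i • SmoothFn.partialDeriv i g) := by
  filter_upwards [h.pd 0, h.pd 1, h.pd 2] with x h0 h1 h2
  simp only [Transport.advect, Fin.sum_univ_three, h0, h1, h2]
  rfl

theorem pdMulti_advect (h : HasGerm f z g) (a : Fin 3 → ℕ) :
    Transport.pdMulti a (Transport.advect f) z = Transport.advect (Transport.pdMulti a f) z := by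
  rw [(h.advect.pdMulti a).eq, (h.pdMulti a).advect.eq]
  simp only [map_sum, map_smul, SmoothFn.multiDeriv_partialDeriv]

theorem congr (h : HasGerm f z g) {U : Set Phase} (hU : IsOpen U) (hz : z ∈ U)
    (hff' : EqOn f' f U) : HasGerm f' z g := by
  have hc : ContinuousAt (fun x : V3 => ((x, z.2) : Phase)) z.1 := by fun_prop
  filter_upwards [h, hc (hU.mem_nhds hz)] with x hx hxU
  rw [← hx]
  exact hff' hxU

end HasGerm

theorem exists_hasGerm_of_forall_isCx {f : Phase → ℝ} (hf : ∀ k, IsCx k f) (z : Phase) :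
    ∃ g, HasGerm f z g :=
  ⟨⟨fun x => f (x, z.2), contDiff_infty.2 fun k => (hf k).contDiff z.2⟩, .refl _ _⟩

-- The extensions of `ψ` may depend on the order of differentiability, hence the bump function.
theorem exists_hasGerm_of_mem_smoothSpace {G : Set V3} (hG : IsOpen G) {E₀ Eₘ : ℝ}
    {ψ : Phase → ℝ} (hψ : ψ ∈ smoothSpace G E₀ Eₘ) {z : Phase} (hz : z ∈ phaseInterior G E₀ Eₘ) :
    ∃ g, HasGerm ψ z g := by
  obtain ⟨r, hr, hball⟩ := Metric.isOpen_iff.1 hG z.1 hz.1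
  let b : ContDiffBump z.1 := ⟨r / 2, r, by positivity, by linarith⟩
  have hsmooth (k : ℕ) : ContDiff ℝ k fun x => b x * ψ (x, z.2) := by
    obtain ⟨⟨f, hf, hψf⟩, -⟩ := hψ (k + 1) (by omega)
    have heq : (fun x => b x * ψ (x, z.2)) = fun x => b x * f (x, z.2) := by
      funext x
      by_cases hx : x ∈ Metric.ball z.1 r
      · rw [hψf (show (x, z.2) ∈ phaseInterior G E₀ Eₘ from ⟨hball hx, hz.2⟩)]
      · have hb : b x = 0 := Function.notMem_support.1 (by rwa [b.support_eq])
        rw [hb, zero_mul, zero_mul]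
    rw [heq]
    exact b.contDiff.mul (hf.1.pred.contDiff z.2)
  refine ⟨⟨fun x => b x * ψ (x, z.2), contDiff_infty.2 hsmooth⟩, ?_⟩
  exact b.eventuallyEq_one.mono fun x hx => by simp only [hx, Pi.one_apply, one_mul]

/-! ### The space of smooth functions vanishing near the inflow boundary -/

variable {m : ℕ} {G : Set V3} {E₀ Eₘ : ℝ}

theorem phaseSupport_add_subset (ψ φ : Phase → ℝ) :
    phaseSupport G E₀ Eₘ (ψ + φ) ⊆ phaseSupport G E₀ Eₘ ψ ∪ phaseSupport G E₀ Eₘ φ := by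
  rw [phaseSupport, phaseSupport, phaseSupport, ← closure_union, ← union_inter_distrib_right]
  exact closure_mono (inter_subset_inter_left _ (Function.support_add ψ φ))

theorem phaseSupport_dirDeriv_subset (hG : IsOpen G) (v : Sph × ℝ → V3) (ψ : Phase → ℝ) :
    phaseSupport G E₀ Eₘ (dirDeriv v ψ) ⊆ phaseSupport G E₀ Eₘ ψ := by
  refine closure_minimal ?_ isClosed_closure
  rintro z ⟨hz0, hz⟩
  by_contra hzs
  have hU : IsOpen (phaseInterior G E₀ Eₘ ∩ (phaseSupport G E₀ Eₘ ψ)ᶜ) :=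
    (isOpen_phaseInterior hG _ _).inter isClosed_closure.isOpen_compl
  have h0 : EqOn ψ (fun _ => 0) (phaseInterior G E₀ Eₘ ∩ (phaseSupport G E₀ Eₘ ψ)ᶜ) :=
    fun z' hz' => apply_eq_zero_of_notMem_phaseSupport hz'.1 hz'.2
  exact hz0 ((dirDeriv_congr hU h0 v ⟨hz, hzs⟩).trans (dirDeriv_zero v z))

theorem dirDeriv_mem_smoothSpace (hG : IsOpen G) {v : Sph × ℝ → V3} (hv : Continuous v)
    {ψ : Phase → ℝ} (hψ : ψ ∈ smoothSpace G E₀ Eₘ) : dirDeriv v ψ ∈ smoothSpace G E₀ Eₘ := by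
  intro k _
  obtain ⟨⟨f, hf, hψf⟩, hdisj⟩ := hψ (k + 1) (by omega)
  exact ⟨⟨_, hf.dirDeriv hv, dirDeriv_congr (isOpen_phaseInterior hG _ _) hψf v⟩,
    hdisj.mono_left (phaseSupport_dirDeriv_subset hG v ψ)⟩

theorem advect_mem_smoothSpace (hG : IsOpen G) {ψ : Phase → ℝ} (hψ : ψ ∈ smoothSpace G E₀ Eₘ) :
    advect ψ ∈ smoothSpace G E₀ Eₘ :=
  dirDeriv_mem_smoothSpace hG continuous_direction hψ

theorem pd_iterate_mem_smoothSpace (hG : IsOpen G) (i : Fin 3) (n : ℕ) {ψ : Phase → ℝ}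
    (hψ : ψ ∈ smoothSpace G E₀ Eₘ) : (pd i)^[n] ψ ∈ smoothSpace G E₀ Eₘ := by
  induction n with
  | zero => exact hψ
  | succ n ih =>
    rw [Function.iterate_succ_apply', ← dirDeriv_basisVec]
    exact dirDeriv_mem_smoothSpace hG continuous_const ih

theorem pdMulti_mem_smoothSpace (hG : IsOpen G) (a : Fin 3 → ℕ) {ψ : Phase → ℝ}
    (hψ : ψ ∈ smoothSpace G E₀ Eₘ) : pdMulti a ψ ∈ smoothSpace G E₀ Eₘ :=
  pd_iterate_mem_smoothSpace hG _ _ <| pd_iterate_mem_smoothSpace hG _ _ <|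
    pd_iterate_mem_smoothSpace hG _ _ hψ

theorem mul_mem_smoothSpace {ϕ ψ : Phase → ℝ} (hϕ : ∀ k, IsCx k ϕ)
    (hψ : ψ ∈ smoothSpace G E₀ Eₘ) : (fun z => ϕ z * ψ z) ∈ smoothSpace G E₀ Eₘ := fun k hk =>
  let ⟨⟨f, hf, hψf⟩, hdisj⟩ := hψ k hk
  ⟨⟨_, .mul_left (hϕ k) hf, fun z hz => by simp only [hψf hz]⟩,
    hdisj.mono_left phaseSupport_mul_left_subset⟩

theorem add_mem_smoothSpace {ψ ψ' : Phase → ℝ} (hψ : ψ ∈ smoothSpace G E₀ Eₘ)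
    (hψ' : ψ' ∈ smoothSpace G E₀ Eₘ) : ψ + ψ' ∈ smoothSpace G E₀ Eₘ := fun k hk =>
  let ⟨⟨_, hf, hψf⟩, hdisj⟩ := hψ k hk
  let ⟨⟨_, hf', hψf'⟩, hdisj'⟩ := hψ' k hk
  ⟨⟨_, hf.add hf', fun _ hz => congrArg₂ (· + ·) (hψf hz) (hψf' hz)⟩,
    (hdisj.union_left hdisj').mono_left (phaseSupport_add_subset ψ ψ')⟩

variable (G E₀ Eₘ) in
/-- `smoothSpace` as a vector space. -/
def smoothSubmodule : Submodule ℝ (Phase → ℝ) where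
  carrier := smoothSpace G E₀ Eₘ
  add_mem' := add_mem_smoothSpace
  zero_mem' := fun k _ =>
    ⟨⟨fun _ => 0, ⟨.of_snd k (b := fun _ => 0) continuous_const, .zero⟩, fun _ _ => rfl⟩, by simp⟩
  smul_mem' := fun c _ => mul_mem_smoothSpace fun k => .of_snd k (b := fun _ => c) continuous_const

theorem IsCxCompact.memLp_two {k : ℕ} {f : Phase → ℝ} (hf : IsCxCompact k f) {ν : Measure Phase}
    [IsFiniteMeasureOnCompacts ν] : MemLp f 2 ν :=
  hf.1.continuous.memLp_of_hasCompactSupport hf.2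

theorem memLp_two_of_mem_smoothSpace (hG : IsOpen G) {ψ : Phase → ℝ}
    (hψ : ψ ∈ smoothSpace G E₀ Eₘ) : MemLp ψ 2 (phaseMeasure G E₀ Eₘ) := by
  obtain ⟨⟨f, hf, hψf⟩, -⟩ := hψ 1 le_rfl
  refine (memLp_congr_ae ?_).2 hf.memLp_two
  exact (ae_mem_phaseInterior hG.measurableSet E₀ Eₘ).mono hψf

/-! ### Families of derivatives -/

/-- The exponents of a multi-index. -/
abbrev MultiIndex.exps (α : MultiIndex m) : Fin 3 → ℕ := fun i => (α.1 i : ℕ)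

theorem pdMulti_congr (hG : IsOpen G) {ψ ψ' : Phase → ℝ} (hψ : ψ ∈ smoothSpace G E₀ Eₘ)
    (h : EqOn ψ' ψ (phaseInterior G E₀ Eₘ)) (a : Fin 3 → ℕ) :
    EqOn (pdMulti a ψ') (pdMulti a ψ) (phaseInterior G E₀ Eₘ) := fun z hz => by
  obtain ⟨g, hg⟩ := exists_hasGerm_of_mem_smoothSpace hG hψ hz
  rw [(hg.pdMulti a).eq, ((hg.congr (isOpen_phaseInterior hG _ _) hz h).pdMulti a).eq]

namespace IsL2Jet

variable {ψ ψ' : Phase → ℝ} {u u' : L2Jet m G E₀ Eₘ}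

theorem unique (hu : IsL2Jet ψ u) (hu' : IsL2Jet ψ u') : u = u' :=
  PiLp.ext fun α => Lp.ext ((hu α).trans (hu' α).symm)

theorem of_ae (hG : MeasurableSet G)
    (h : ∀ α : MultiIndex m, ∀ᵐ z ∂(phaseMeasure G E₀ Eₘ), z ∈ phaseInterior G E₀ Eₘ →
      u α z = pdMulti α.exps ψ z) : IsL2Jet ψ u := fun α => by
  filter_upwards [h α, ae_mem_phaseInterior hG E₀ Eₘ] with z hz hzi using hz hzi

theorem congr (hG : IsOpen G) (hψ : ψ ∈ smoothSpace G E₀ Eₘ)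
    (h : EqOn ψ' ψ (phaseInterior G E₀ Eₘ)) (hu : IsL2Jet ψ u) : IsL2Jet ψ' u :=
  of_ae hG.measurableSet fun α =>
    (hu α).mono fun _ hz hzi => hz.trans (pdMulti_congr hG hψ h _ hzi).symm

theorem add (hG : IsOpen G) (hψ : ψ ∈ smoothSpace G E₀ Eₘ) (hψ' : ψ' ∈ smoothSpace G E₀ Eₘ)
    (hu : IsL2Jet ψ u) (hu' : IsL2Jet ψ' u') : IsL2Jet (ψ + ψ') (u + u') :=
  of_ae hG.measurableSet fun α => by
    filter_upwards [hu α, hu' α, Lp.coeFn_add (u α) (u' α)] with z h1 h2 h3 hz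
    obtain ⟨g, hg⟩ := exists_hasGerm_of_mem_smoothSpace hG hψ hz
    obtain ⟨g', hg'⟩ := exists_hasGerm_of_mem_smoothSpace hG hψ' hz
    have hadd : pdMulti α.exps (ψ + ψ') z = _ := ((hg.add hg').pdMulti _).eq
    rw [hadd, PiLp.add_apply, h3, Pi.add_apply, h1, h2, map_add, (hg.pdMulti α.exps).eq,
      (hg'.pdMulti α.exps).eq]
    rfl

theorem smul (hG : IsOpen G) (hψ : ψ ∈ smoothSpace G E₀ Eₘ) (hu : IsL2Jet ψ u) (c : ℝ) :
    IsL2Jet (c • ψ) (c • u) :=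
  of_ae hG.measurableSet fun α => by
    filter_upwards [hu α, Lp.coeFn_smul c (u α)] with z h1 h3 hz
    obtain ⟨g, hg⟩ := exists_hasGerm_of_mem_smoothSpace hG hψ hz
    have hsmul : pdMulti α.exps (c • ψ) z = _ := ((hg.const_mul c).pdMulti _).eq
    rw [hsmul, PiLp.smul_apply, h3, Pi.smul_apply, h1, map_smul, (hg.pdMulti α.exps).eq]
    rfl

theorem advect (hG : IsOpen G) (hψ : ψ ∈ smoothSpace G E₀ Eₘ) (hu : IsL2Jet (advect ψ) u)
    (α : MultiIndex m) :
    u α =ᵐ[phaseMeasure G E₀ Eₘ] Transport.advect (pdMulti α.exps ψ) := by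
  filter_upwards [hu α, ae_mem_phaseInterior hG.measurableSet E₀ Eₘ] with z hz hzi
  obtain ⟨g, hg⟩ := exists_hasGerm_of_mem_smoothSpace hG hψ hzi
  rw [hz, hg.pdMulti_advect]

end IsL2Jet

theorem advect_add_eqOn (hG : IsOpen G) {ψ ψ' : Phase → ℝ} (hψ : ψ ∈ smoothSpace G E₀ Eₘ)
    (hψ' : ψ' ∈ smoothSpace G E₀ Eₘ) :
    EqOn (advect (ψ + ψ')) (advect ψ + advect ψ') (phaseInterior G E₀ Eₘ) := fun z hz => by
  obtain ⟨g, hg⟩ := exists_hasGerm_of_mem_smoothSpace hG hψ hz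
  obtain ⟨g', hg'⟩ := exists_hasGerm_of_mem_smoothSpace hG hψ' hz
  refine (hg.add hg').advect.eq.trans (((hg.advect.add hg'.advect).eq).trans ?_).symm
  simp only [map_add, smul_add, Finset.sum_add_distrib]

theorem advect_smul_eqOn (hG : IsOpen G) {ψ : Phase → ℝ} (hψ : ψ ∈ smoothSpace G E₀ Eₘ) (c : ℝ) :
    EqOn (advect (c • ψ)) (c • advect ψ) (phaseInterior G E₀ Eₘ) := fun z hz => by
  obtain ⟨g, hg⟩ := exists_hasGerm_of_mem_smoothSpace hG hψ hz
  refine (hg.const_mul c).advect.eq.trans ((hg.advect.const_mul c).eq.trans ?_).symm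
  simp only [Derivation.map_smul, Finset.smul_sum, smul_comm c]

/-- The family of the derivatives of a function, as an element of `L²`. -/
def jetOfMem (m : ℕ) (hG : IsOpen G) {ψ : Phase → ℝ} (hψ : ψ ∈ smoothSpace G E₀ Eₘ) :
    L2Jet m G E₀ Eₘ :=
  WithLp.toLp 2 fun α : MultiIndex m =>
    (memLp_two_of_mem_smoothSpace hG (pdMulti_mem_smoothSpace hG α.exps hψ)).toLp _

theorem isL2Jet_jetOfMem (hG : IsOpen G) {ψ : Phase → ℝ} (hψ : ψ ∈ smoothSpace G E₀ Eₘ) :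
    IsL2Jet ψ (jetOfMem m hG hψ) := fun α =>
  (memLp_two_of_mem_smoothSpace hG (pdMulti_mem_smoothSpace hG α.exps hψ)).coeFn_toLp

/-- The map `ψ ↦ (∂ₓ^α ψ)_α`. -/
def jet (m : ℕ) (hG : IsOpen G) : smoothSubmodule G E₀ Eₘ →ₗ[ℝ] L2Jet m G E₀ Eₘ where
  toFun ψ := jetOfMem m hG ψ.2
  map_add' ψ ψ' := (isL2Jet_jetOfMem hG (ψ + ψ').2).unique
    ((isL2Jet_jetOfMem hG ψ.2).add hG ψ.2 ψ'.2 (isL2Jet_jetOfMem hG ψ'.2))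
  map_smul' c ψ := (isL2Jet_jetOfMem hG (c • ψ).2).unique
    ((isL2Jet_jetOfMem hG ψ.2).smul hG ψ.2 c)

theorem isL2Jet_jet (hG : IsOpen G) (ψ : smoothSubmodule G E₀ Eₘ) : IsL2Jet ψ (jet m hG ψ) :=
  isL2Jet_jetOfMem hG ψ.2

/-- The map `ψ ↦ (∂ₓ^α (ω · ∇ₓ ψ))_α`. -/
def advectJet (m : ℕ) (hG : IsOpen G) : smoothSubmodule G E₀ Eₘ →ₗ[ℝ] L2Jet m G E₀ Eₘ where
  toFun ψ := jetOfMem m hG (advect_mem_smoothSpace hG ψ.2)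
  map_add' ψ ψ' := by
    have hψ := advect_mem_smoothSpace hG ψ.2
    have hψ' := advect_mem_smoothSpace hG ψ'.2
    exact (isL2Jet_jetOfMem hG _).unique <|
      ((isL2Jet_jetOfMem hG hψ).add hG hψ hψ' (isL2Jet_jetOfMem hG hψ')).congr hG
        (add_mem_smoothSpace hψ hψ') (advect_add_eqOn hG ψ.2 ψ'.2)
  map_smul' c ψ := by
    have hψ := advect_mem_smoothSpace hG ψ.2
    exact (isL2Jet_jetOfMem hG _).unique <|
      ((isL2Jet_jetOfMem hG hψ).smul hG hψ c).congr hG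
        ((smoothSubmodule G E₀ Eₘ).smul_mem c hψ) (advect_smul_eqOn hG ψ.2 c)

theorem isL2Jet_advectJet (hG : IsOpen G) (ψ : smoothSubmodule G E₀ Eₘ) :
    IsL2Jet (advect ψ) (advectJet m hG ψ) :=
  isL2Jet_jetOfMem hG (advect_mem_smoothSpace hG ψ.2)

/-- The space `H0` as a submodule. -/
def H0Submodule (m : ℕ) (hG : IsOpen G) (E₀ Eₘ : ℝ) : Submodule ℝ (L2Jet m G E₀ Eₘ) :=
  (LinearMap.range (jet m hG)).topologicalClosure

theorem mem_range_jet_iff (hG : IsOpen G) {u : L2Jet m G E₀ Eₘ} :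
    u ∈ LinearMap.range (jet m hG) ↔ ∃ ψ ∈ smoothSpace G E₀ Eₘ, IsL2Jet ψ u :=
  ⟨fun ⟨ψ, hψ⟩ => ⟨ψ, ψ.2, hψ ▸ isL2Jet_jet hG ψ⟩,
    fun ⟨ψ, hψ, hu⟩ => ⟨⟨ψ, hψ⟩, (isL2Jet_jet hG ⟨ψ, hψ⟩).unique hu⟩⟩

theorem coe_H0Submodule (hG : IsOpen G) : (H0Submodule m hG E₀ Eₘ : Set _) = H0 m G E₀ Eₘ :=
  congrArg closure (Set.ext fun _ => mem_range_jet_iff hG)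

theorem mem_H0_of_isL2Jet {ψ : Phase → ℝ} (hψ : ψ ∈ smoothSpace G E₀ Eₘ) {u : L2Jet m G E₀ Eₘ}
    (hu : IsL2Jet ψ u) : u ∈ H0 m G E₀ Eₘ :=
  subset_closure ⟨ψ, hψ, hu⟩

/-- The graph of the closure of the streaming operator `ψ ↦ ω · ∇ₓ ψ` in `H0`. -/
def streamGraph (m : ℕ) (hG : IsOpen G) (E₀ Eₘ : ℝ) :
    Submodule ℝ (L2Jet m G E₀ Eₘ × L2Jet m G E₀ Eₘ) :=
  (LinearMap.range ((jet m hG).prod (advectJet m hG))).topologicalClosure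

/-! ### Multiplication of families of derivatives -/

/-- The componentwise truncated difference of multi-indices. -/
def MultiIndex.sub (α β : MultiIndex m) : MultiIndex m :=
  ⟨fun i => ⟨α.1 i - β.1 i, by omega⟩,
    (Finset.sum_le_sum fun _ _ => Nat.sub_le _ _).trans α.2⟩

/-- The coefficient of `∂^β f ∂^(α-β) g` in the Leibniz formula for `∂^α (f g)`; it vanishes unless
`β ≤ α`. -/
def leibnizCoeff (α β : MultiIndex m) : ℕ := ∏ i, (α.exps i).choose (β.exps i)

/-- The sum of the coefficients of all Leibniz formulas of order at most `m`. -/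
def leibnizConst (m : ℕ) : ℕ := ∑ α : MultiIndex m, ∑ β : MultiIndex m, leibnizCoeff α β

theorem prod_choose_eq_zero {ι : Type*} [Fintype ι] {a b : ι → ℕ} (h : ¬ b ≤ a) :
    ∏ i, (a i).choose (b i) = 0 := by
  obtain ⟨i, hi⟩ := not_forall.1 h
  exact Finset.prod_eq_zero (Finset.mem_univ i) (Nat.choose_eq_zero_of_lt (not_le.1 hi))

theorem MultiIndex.zeroIndex_sub (β : MultiIndex m) : (zeroIndex m).sub β = zeroIndex m := by
  simp [MultiIndex.sub, zeroIndex]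

theorem leibnizCoeff_zeroIndex (β : MultiIndex m) :
    leibnizCoeff (zeroIndex m) β = if β = zeroIndex m then 1 else 0 := by
  split_ifs with hβ
  · simp [hβ, leibnizCoeff, zeroIndex]
  · refine prod_choose_eq_zero fun hle => hβ (Subtype.ext <| funext fun i => Fin.ext ?_)
    exact Nat.le_zero.1 (hle i)

theorem leibnizConst_pos (m : ℕ) : 0 < leibnizConst m := by
  have hzero : 0 < leibnizCoeff (zeroIndex m) (zeroIndex m) := by simp [leibnizCoeff_zeroIndex]
  exact hzero.trans_le <| (Finset.single_le_sum (fun _ _ => zero_le) (Finset.mem_univ _)).trans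
    (Finset.single_le_sum (f := fun α => ∑ β, leibnizCoeff α β) (fun _ _ => zero_le)
      (Finset.mem_univ (zeroIndex m)))

theorem SmoothFn.multiDeriv_exps_mul (α : MultiIndex m) (f g : SmoothFn) :
    multiDeriv α.exps (f * g) = ∑ β : MultiIndex m,
      leibnizCoeff α β • (multiDeriv β.exps f * multiDeriv (α.sub β).exps g) := by
  let term (b : Fin 3 → Fin (m + 1)) : SmoothFn := (∏ i, (α.exps i).choose (b i)) •
    (multiDeriv (fun i => b i) f * multiDeriv (fun i => α.exps i - b i) g)
  have hbig (b : Fin 3 → Fin (m + 1)) (hb : ¬ ∑ i, (b i : ℕ) ≤ m) : term b = 0 := by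
    have hnot : ¬ (fun i => (b i : ℕ)) ≤ α.exps := fun hle =>
      hb ((Finset.sum_le_sum fun i _ => hle i).trans α.2)
    simp only [term, prod_choose_eq_zero hnot, zero_smul]
  calc multiDeriv α.exps (f * g) = ∑ b, term b :=
        multiDeriv_mul (fun i => Nat.lt_succ_iff.1 (α.1 i).2) f g
    _ = ∑ b with ∑ i, (b i : ℕ) ≤ m, term b :=
        (Finset.sum_subset (Finset.filter_subset _ _) fun b _ hb => hbig b (by simpa using hb)).symm
    _ = ∑ β : MultiIndex m, term β.1 := Finset.sum_subtype _ (by simp) term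

theorem HasGerm.pdMulti_mul {f f' : Phase → ℝ} {z : Phase} {g g' : SmoothFn} (h : HasGerm f z g)
    (h' : HasGerm f' z g') (α : MultiIndex m) :
    Transport.pdMulti α.exps (fun z => f z * f' z) z = ∑ β, leibnizCoeff α β •
      (Transport.pdMulti β.exps f z * Transport.pdMulti (α.sub β).exps f' z) := by
  simp only [((h.mul h').pdMulti _).eq, (h.pdMulti _).eq, (h'.pdMulti _).eq,
    SmoothFn.multiDeriv_exps_mul, AddSubmonoidClass.coe_finsetSum, Finset.sum_apply]
  rfl

theorem norm_toLp_le_sum {ι : Type*} [Fintype ι] {β : ι → Type*}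
    [∀ i, SeminormedAddCommGroup (β i)] (x : ∀ i, β i) : ‖WithLp.toLp 2 x‖ ≤ ∑ i, ‖x i‖ := by
  rw [PiLp.norm_eq_of_L2, Real.sqrt_le_iff]
  exact ⟨Finset.sum_nonneg fun _ _ => norm_nonneg _,
    Finset.sum_sq_le_sq_sum_of_nonneg fun _ _ => norm_nonneg _⟩

/-- The family `(∂ₓ^α (Σ ψ))_α` given by the Leibniz formula in terms of the families `s` and `u`
of the derivatives of `Σ` and `ψ`. -/
def jetMulFun (s : LinftyJet m G E₀ Eₘ) (u : L2Jet m G E₀ Eₘ) : L2Jet m G E₀ Eₘ :=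
  WithLp.toLp 2 fun α => ∑ β, leibnizCoeff α β •
    (s β • u (α.sub β) : Lp ℝ 2 (phaseMeasure G E₀ Eₘ))

theorem norm_jetMulFun_le (s : LinftyJet m G E₀ Eₘ) (u : L2Jet m G E₀ Eₘ) :
    ‖jetMulFun s u‖ ≤ leibnizConst m * ‖s‖ * ‖u‖ := by
  have hterm (α β : MultiIndex m) :
      ‖leibnizCoeff α β • (s β • u (α.sub β) : Lp ℝ 2 (phaseMeasure G E₀ Eₘ))‖ ≤
        leibnizCoeff α β * (‖s‖ * ‖u‖) := by
    refine (norm_nsmul_le).trans ?_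
    gcongr
    exact (Lp.norm_smul_le _ _).trans <|
      mul_le_mul (norm_le_pi_norm s β) (PiLp.norm_apply_le u _) (norm_nonneg _) (norm_nonneg _)
  calc ‖jetMulFun s u‖
      ≤ ∑ α, ‖∑ β, leibnizCoeff α β • (s β • u (α.sub β) : Lp ℝ 2 (phaseMeasure G E₀ Eₘ))‖ :=
        norm_toLp_le_sum _
    _ ≤ ∑ α, ∑ β, (leibnizCoeff α β : ℝ) * (‖s‖ * ‖u‖) :=
        Finset.sum_le_sum fun α _ => norm_sum_le_of_le _ fun β _ => hterm α β
    _ = leibnizConst m * ‖s‖ * ‖u‖ := by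
        simp only [leibnizConst, Nat.cast_sum, Finset.sum_mul, mul_assoc]

/-- The Leibniz product of families of derivatives as a bounded bilinear map. -/
def jetMul : LinftyJet m G E₀ Eₘ →L[ℝ] L2Jet m G E₀ Eₘ →L[ℝ] L2Jet m G E₀ Eₘ :=
  LinearMap.mkContinuous₂
    (LinearMap.mk₂ ℝ jetMulFun
      (fun s s' u => PiLp.ext fun α => by
        simp [jetMulFun, Lp.smul_add, Finset.sum_add_distrib])
      (fun c s u => PiLp.ext fun α => by
        simp [jetMulFun, Lp.smul_assoc, Finset.smul_sum, smul_comm c])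
      (fun s u u' => PiLp.ext fun α => by
        simp [jetMulFun, Lp.add_smul, Finset.sum_add_distrib])
      (fun c s u => PiLp.ext fun α => by
        simp [jetMulFun, ← Lp.smul_comm, Finset.smul_sum, smul_comm c]))
    (leibnizConst m) norm_jetMulFun_le

theorem coeFn_jetMul (s : LinftyJet m G E₀ Eₘ) (u : L2Jet m G E₀ Eₘ) (α : MultiIndex m) :
    jetMul s u α =ᵐ[phaseMeasure G E₀ Eₘ]
      fun z => ∑ β, leibnizCoeff α β • (s β z * u (α.sub β) z) := by
  have hterm (β : MultiIndex m) :
      (leibnizCoeff α β • (s β • u (α.sub β) : Lp ℝ 2 (phaseMeasure G E₀ Eₘ)) : Lp ℝ 2 _)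
        =ᵐ[phaseMeasure G E₀ Eₘ] fun z => leibnizCoeff α β • (s β z * u (α.sub β) z) := by
    rw [← Nat.cast_smul_eq_nsmul ℝ]
    filter_upwards [Lp.coeFn_smul (leibnizCoeff α β : ℝ)
      (s β • u (α.sub β) : Lp ℝ 2 (phaseMeasure G E₀ Eₘ)),
      Lp.coeFn_lpSMul (r := 2) (s β) (u (α.sub β))] with z h1 h2
    rw [h1, Pi.smul_apply, h2, Nat.cast_smul_eq_nsmul]
    rfl
  refine (Lp.coeFn_finsetSum _ _).trans ?_
  filter_upwards [ae_all_iff.2 hterm] with z hz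
  rw [Finset.sum_apply]
  exact Finset.sum_congr rfl fun β _ => hz β

theorem coeFn_jetMul_zeroIndex (s : LinftyJet m G E₀ Eₘ) (u : L2Jet m G E₀ Eₘ) :
    jetMul s u (zeroIndex m) =ᵐ[phaseMeasure G E₀ Eₘ]
      fun z => s (zeroIndex m) z * u (zeroIndex m) z :=
  (coeFn_jetMul s u _).trans <| .of_forall fun z => by
    simp [leibnizCoeff_zeroIndex, MultiIndex.zeroIndex_sub]

theorem IsL2Jet.mul (hG : IsOpen G) {ϕ ψ : Phase → ℝ} {s : LinftyJet m G E₀ Eₘ}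
    {u : L2Jet m G E₀ Eₘ} (hϕ : ∀ k, IsCx k ϕ) (hs : IsLinftyJet ϕ s)
    (hψ : ψ ∈ smoothSpace G E₀ Eₘ) (hu : IsL2Jet ψ u) :
    IsL2Jet (fun z => ϕ z * ψ z) (jetMul s u) :=
  IsL2Jet.of_ae hG.measurableSet fun α => by
    filter_upwards [coeFn_jetMul s u α, ae_all_iff.2 hs, ae_all_iff.2 hu] with z h1 h2 h3 hz
    obtain ⟨g, hg⟩ := exists_hasGerm_of_forall_isCx hϕ z
    obtain ⟨g', hg'⟩ := exists_hasGerm_of_mem_smoothSpace hG hψ hz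
    rw [h1, hg.pdMulti_mul hg']
    exact Finset.sum_congr rfl fun β _ => by rw [h2, h3]

theorem jetMul_mem_H0 (hG : IsOpen G) {s : LinftyJet m G E₀ Eₘ} {u : L2Jet m G E₀ Eₘ}
    (hs : s ∈ coeffSpace m G E₀ Eₘ) (hu : u ∈ H0 m G E₀ Eₘ) : jetMul s u ∈ H0 m G E₀ Eₘ := by
  have hcont : Continuous fun p : LinftyJet m G E₀ Eₘ × L2Jet m G E₀ Eₘ => jetMul p.1 p.2 :=
    (jetMul (m := m)).continuous₂
  refine map_mem_closure₂ (f := fun s u => jetMul s u) hcont hs hu ?_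
  rintro s ⟨ϕ, hϕ, hs⟩ u ⟨ψ, hψ, hu⟩
  exact ⟨_, mul_mem_smoothSpace (fun k => (hϕ k).1) hψ, hu.mul hG (fun k => (hϕ k).1) hs hψ⟩

theorem multiplicationBound_leibnizConst (hG : IsOpen G) (m : ℕ) (E₀ Eₘ : ℝ) :
    MultiplicationBound m G E₀ Eₘ (leibnizConst m) := fun s hs u hu =>
  ⟨jetMul s u, jetMul_mem_H0 hG hs hu, coeFn_jetMul_zeroIndex s u, norm_jetMulFun_le s u⟩

/-! ### Weak derivatives -/

/-- Test functions for weak derivatives in `x`: their support lies over `G`, but it may reach all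
directions and energies, in which nothing is differentiated. -/
structure IsTest (G : Set V3) (φ : Phase → ℝ) : Prop where
  isCxCompact : ∀ k, IsCxCompact k φ
  tsupport_subset : tsupport φ ⊆ Prod.fst ⁻¹' G

theorem IsTest.neg_pd {φ : Phase → ℝ} (hφ : IsTest G φ) (i : Fin 3) :
    IsTest G fun z => -1 * pd i φ z where
  isCxCompact k :=
    .mul_left (.of_snd k (b := fun _ => -1) continuous_const) ((hφ.isCxCompact (k + 1)).pd i)
  tsupport_subset := by
    refine Subset.trans (closure_minimal (fun z hz => ?_) (isClosed_tsupport φ)) hφ.tsupport_subset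
    by_contra hzφ
    rw [Function.mem_support, ← dirDeriv_basisVec, dirDeriv_eq_zero_of_notMem_tsupport _ hzφ] at hz
    simp at hz

theorem IsTest.integral_dirDeriv_mul (hG : IsOpen G) {φ : Phase → ℝ} (hφ : IsTest G φ)
    {v : Sph × ℝ → V3} (hv : Continuous v) {ψ : Phase → ℝ} (hψ : ψ ∈ smoothSpace G E₀ Eₘ) :
    ∫ z, dirDeriv v ψ z * φ z ∂(phaseMeasure G E₀ Eₘ) =
      -∫ z, ψ z * dirDeriv v φ z ∂(phaseMeasure G E₀ Eₘ) := by
  obtain ⟨⟨f, hf, hψf⟩, -⟩ := hψ 1 le_rfl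
  exact Transport.integral_dirDeriv_mul hG hv hf.1 hψf (hφ.isCxCompact 1) <|
    phaseSupport_mul_left_subset.trans <| phaseSupport_subset_tsupport.trans hφ.tsupport_subset

theorem IsTest.exists_adjoint_pd_iterate (hG : IsOpen G) (E₀ Eₘ : ℝ) {φ : Phase → ℝ}
    (hφ : IsTest G φ) (i : Fin 3) (n : ℕ) :
    ∃ φ', IsTest G φ' ∧ ∀ ψ ∈ smoothSpace G E₀ Eₘ,
      ∫ z, (pd i)^[n] ψ z * φ z ∂(phaseMeasure G E₀ Eₘ) =
        ∫ z, ψ z * φ' z ∂(phaseMeasure G E₀ Eₘ) := by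
  induction n generalizing φ with
  | zero => exact ⟨φ, hφ, fun _ _ => rfl⟩
  | succ n ih =>
    obtain ⟨φ', hφ', hadj⟩ := ih (hφ.neg_pd i)
    refine ⟨φ', hφ', fun ψ hψ => (Eq.trans ?_ (hadj ψ hψ))⟩
    have hparts := hφ.integral_dirDeriv_mul hG (v := fun _ => basisVec i) continuous_const
      (pd_iterate_mem_smoothSpace hG i n hψ)
    rw [dirDeriv_basisVec, dirDeriv_basisVec] at hparts
    rw [Function.iterate_succ_apply', hparts, ← integral_neg]
    simp

theorem IsTest.exists_adjoint_pdMulti (hG : IsOpen G) (E₀ Eₘ : ℝ) {φ : Phase → ℝ}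
    (hφ : IsTest G φ) (a : Fin 3 → ℕ) :
    ∃ φ', IsTest G φ' ∧ ∀ ψ ∈ smoothSpace G E₀ Eₘ,
      ∫ z, pdMulti a ψ z * φ z ∂(phaseMeasure G E₀ Eₘ) =
        ∫ z, ψ z * φ' z ∂(phaseMeasure G E₀ Eₘ) := by
  obtain ⟨φ₀, hφ₀, h₀⟩ := hφ.exists_adjoint_pd_iterate hG E₀ Eₘ 0 (a 0)
  obtain ⟨φ₁, hφ₁, h₁⟩ := hφ₀.exists_adjoint_pd_iterate hG E₀ Eₘ 1 (a 1)
  obtain ⟨φ₂, hφ₂, h₂⟩ := hφ₁.exists_adjoint_pd_iterate hG E₀ Eₘ 2 (a 2)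
  refine ⟨φ₂, hφ₂, fun ψ hψ => ?_⟩
  have hψ₂ := pd_iterate_mem_smoothSpace hG 2 (a 2) hψ
  have hψ₁ := pd_iterate_mem_smoothSpace hG 1 (a 1) hψ₂
  exact (h₀ _ hψ₁).trans ((h₁ _ hψ₂).trans (h₂ _ hψ))

theorem continuous_integral_mul {X : Type*} [MeasurableSpace X] {μ : Measure X} {φ : X → ℝ}
    (hφ : MemLp φ 2 μ) : Continuous fun w : Lp ℝ 2 μ => ∫ x, w x * φ x ∂μ := by
  have hinner (w : Lp ℝ 2 μ) : ∫ x, w x * φ x ∂μ = inner ℝ (hφ.toLp φ) w := by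
    rw [L2.inner_def]
    refine integral_congr_ae ?_
    filter_upwards [hφ.coeFn_toLp] with x hx
    simp [hx]
  simp only [hinner]
  fun_prop

theorem exists_integral_apply_mul_eq (hG : IsOpen G) {φ : Phase → ℝ} (hφ : IsTest G φ)
    (α : MultiIndex m) :
    ∃ φ', IsTest G φ' ∧ ∀ u ∈ H0 m G E₀ Eₘ,
      ∫ z, u α z * φ z ∂(phaseMeasure G E₀ Eₘ) =
        ∫ z, u (zeroIndex m) z * φ' z ∂(phaseMeasure G E₀ Eₘ) := by
  obtain ⟨φ', hφ', hadj⟩ := hφ.exists_adjoint_pdMulti hG E₀ Eₘ α.exps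
  refine ⟨φ', hφ', fun u hu => ?_⟩
  have hcont {χ : Phase → ℝ} (hχ : IsTest G χ) (β : MultiIndex m) :
      Continuous fun u : L2Jet m G E₀ Eₘ => ∫ z, u β z * χ z ∂(phaseMeasure G E₀ Eₘ) :=
    (continuous_integral_mul (hχ.isCxCompact 0).memLp_two).comp (PiLp.continuous_apply 2 _ β)
  refine closure_minimal ?_ (isClosed_eq (hcont hφ α) (hcont hφ' (zeroIndex m))) hu
  rintro u ⟨ψ, hψ, hu⟩
  calc ∫ z, u α z * φ z ∂(phaseMeasure G E₀ Eₘ)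
      = ∫ z, pdMulti α.exps ψ z * φ z ∂(phaseMeasure G E₀ Eₘ) :=
        integral_congr_ae ((hu α).mul .rfl)
    _ = ∫ z, ψ z * φ' z ∂(phaseMeasure G E₀ Eₘ) := hadj ψ hψ
    _ = ∫ z, u (zeroIndex m) z * φ' z ∂(phaseMeasure G E₀ Eₘ) :=
        integral_congr_ae ((hu (zeroIndex m)).symm.mul .rfl)

theorem eq_zero_of_integral_test_eq_zero (hG : IsOpen G) (w : Lp ℝ 2 (phaseMeasure G E₀ Eₘ))
    (hw : ∀ φ, IsTest G φ → ∫ z, w z * φ z ∂(phaseMeasure G E₀ Eₘ) = 0) : w = 0 := by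
  have hemb : MeasurableEmbedding toAmbient := isClosedEmbedding_toAmbient.measurableEmbedding
  let W : V3 × V3 × ℝ → ℝ := Function.extend toAmbient w 0
  have hW (z : Phase) : W (toAmbient z) = w z :=
    isClosedEmbedding_toAmbient.injective.extend_apply _ _ _
  have hint : LocallyIntegrable W ((phaseMeasure G E₀ Eₘ).map toAmbient) := by
    refine locallyIntegrable_iff.2 fun K hK => hemb.integrableOn_map_iff.2 ?_
    rw [show W ∘ toAmbient = w from funext hW]
    exact ((Lp.memLp w).locallyIntegrable one_le_two).integrableOn_isCompact
      (isClosedEmbedding_toAmbient.isCompact_preimage hK)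
  have hU : IsOpen {p : V3 × V3 × ℝ | p.1 ∈ G} := hG.preimage continuous_fst
  have hzero := hU.ae_eq_zero_of_integral_contDiff_smul_eq_zero (hint.locallyIntegrableOn _)
    fun g hg hgc hgU => by
      have hφ : IsTest G fun z => g (toAmbient z) :=
        ⟨fun k => ⟨.comp_toAmbient k hg, hgc.comp_isClosedEmbedding isClosedEmbedding_toAmbient⟩,
          (tsupport_comp_subset_preimage g isClosedEmbedding_toAmbient.continuous).trans
            (preimage_mono hgU)⟩
      simpa only [hemb.integral_map, hW, smul_eq_mul, mul_comm] using hw _ hφ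
  rw [hemb.ae_map_iff] at hzero
  refine Lp.eq_zero_iff_ae_eq_zero.2 ?_
  filter_upwards [hzero, ae_mem_phaseInterior hG.measurableSet E₀ Eₘ] with z hz hzG
  rw [← hW, hz hzG.1, Pi.zero_apply]

theorem eq_of_apply_zeroIndex_ae_eq (hG : IsOpen G) {u v : L2Jet m G E₀ Eₘ}
    (hu : u ∈ H0 m G E₀ Eₘ) (hv : v ∈ H0 m G E₀ Eₘ)
    (h : u (zeroIndex m) =ᵐ[phaseMeasure G E₀ Eₘ] v (zeroIndex m)) : u = v := by
  rw [← coe_H0Submodule hG] at hu hv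
  have huv : u - v ∈ H0 m G E₀ Eₘ := coe_H0Submodule hG ▸ Submodule.sub_mem _ hu hv
  refine sub_eq_zero.1 <| PiLp.ext fun α => eq_zero_of_integral_test_eq_zero hG _ fun φ hφ => ?_
  obtain ⟨φ', -, hadj⟩ := exists_integral_apply_mul_eq hG hφ α
  rw [hadj _ huv, PiLp.sub_apply, Lp.ext h, sub_self]
  refine integral_eq_zero_of_ae ?_
  filter_upwards [Lp.coeFn_zero ℝ 2 (phaseMeasure G E₀ Eₘ)] with z hz
  exact mul_eq_zero_of_left hz _

/-! ### Accretive relations in a Hilbert space -/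

section Accretive

variable {X : Type*} [NormedAddCommGroup X] [InnerProductSpace ℝ X] {A : Submodule ℝ (X × X)}

/-- Accretivity of a possibly multivalued linear operator, given by its graph. -/
def IsAccretive (A : Submodule ℝ (X × X)) : Prop := ∀ p ∈ A, 0 ≤ inner ℝ p.2 p.1

namespace IsAccretive

theorem topologicalClosure (hA : IsAccretive A) : IsAccretive A.topologicalClosure := fun _ hp =>
  closure_minimal (t := {p : X × X | 0 ≤ inner ℝ p.2 p.1}) hA
    (isClosed_le continuous_const (continuous_snd.inner continuous_fst)) hp

theorem mul_norm_le (hA : IsAccretive A) {p : X × X} (hp : p ∈ A) (C : ℝ) :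
    C * ‖p.1‖ ≤ ‖p.2 + C • p.1‖ := by
  rcases (norm_nonneg p.1).eq_or_lt with h0 | h0
  · simp [← h0]
  · refine le_of_mul_le_mul_right ?_ h0
    calc C * ‖p.1‖ * ‖p.1‖ ≤ inner ℝ p.2 p.1 + C * (‖p.1‖ * ‖p.1‖) := by linarith [hA p hp]
      _ = inner ℝ (p.2 + C • p.1) p.1 := by
        rw [inner_add_left, real_inner_smul_left, real_inner_self_eq_norm_mul_norm]
      _ ≤ ‖p.2 + C • p.1‖ * ‖p.1‖ := real_inner_le_norm _ _

theorem eq_of_sub_smul_mem (hA : IsAccretive A) {C : ℝ} (hC : 0 < C) {f u v : X}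
    (hu : (u, f - C • u) ∈ A) (hv : (v, f - C • v) ∈ A) : u = v := by
  have hle := hA.mul_norm_le (A.sub_mem hu hv) C
  have hzero : f - C • u - (f - C • v) + C • (u - v) = 0 := by module
  simp only [Prod.fst_sub, Prod.snd_sub, hzero, norm_zero] at hle
  exact sub_eq_zero.1 (norm_le_zero_iff.1 (nonpos_of_mul_nonpos_right hle hC))

theorem isClosed_image_add_smul [CompleteSpace X] (hA : IsAccretive A)
    (hcl : IsClosed (A : Set (X × X))) {C : ℝ} (hC : 0 < C) :
    IsClosed ((fun p : X × X => p.2 + C • p.1) '' A) := by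
  let T : A →L[ℝ] X :=
    (ContinuousLinearMap.snd ℝ X X + C • ContinuousLinearMap.fst ℝ X X).comp A.subtypeL
  have hbound (p : A) : ‖p‖ ≤ (C⁻¹ + 2).toNNReal * ‖T p‖ := by
    have hfst : C * ‖p.1.1‖ ≤ ‖T p‖ := hA.mul_norm_le p.2 C
    have hfst' : ‖p.1.1‖ ≤ C⁻¹ * ‖T p‖ := (le_inv_mul_iff₀ hC).2 hfst
    have hsnd : ‖p.1.2‖ ≤ 2 * ‖T p‖ :=
      calc ‖p.1.2‖ = ‖T p - C • p.1.1‖ := congrArg norm (add_sub_cancel_right _ _).symm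
        _ ≤ ‖T p‖ + ‖C • p.1.1‖ := norm_sub_le _ _
        _ ≤ 2 * ‖T p‖ := by rw [norm_smul, Real.norm_of_nonneg hC.le]; linarith
    rw [Real.coe_toNNReal _ (by positivity), add_mul]
    exact max_le (hfst'.trans (le_add_of_nonneg_right (by positivity)))
      (hsnd.trans (le_add_of_nonneg_left (by positivity)))
  have : CompleteSpace A := hcl.completeSpace_coe
  rw [image_eq_range]
  exact (T.antilipschitz_of_bound hbound).isClosed_range T.uniformContinuous

variable {H : Submodule ℝ X}

theorem exists_resolvent (hA : IsAccretive A) (hAH : ∀ p ∈ A, p.1 ∈ H) {C : ℝ} (hC : 0 < C)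
    (hsurj : ∀ f ∈ H, ∃ u, (u, f - C • u) ∈ A) :
    ∃ R : H → H, LipschitzWith C⁻¹.toNNReal R ∧
      ∀ (f : H) (u : X), (u, (f : X) - C • u) ∈ A ↔ R f = u := by
  choose R hR using fun f : H => hsurj f f.2
  refine ⟨fun f => ⟨R f, hAH _ (hR f)⟩, .of_dist_le_mul fun f f' => ?_, fun f u =>
    ⟨fun hu => hA.eq_of_sub_smul_mem hC (hR f) hu, fun hu => hu ▸ hR f⟩⟩
  have hle := hA.mul_norm_le (A.sub_mem (hR f) (hR f')) C
  have hdiff : (f : X) - C • R f - (f' - C • R f') + C • (R f - R f') = f - f' := by module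
  simp only [Prod.fst_sub, Prod.snd_sub, hdiff] at hle
  rw [Real.coe_toNNReal _ (by positivity), Subtype.dist_eq, Subtype.dist_eq, dist_eq_norm,
    dist_eq_norm]
  exact (le_inv_mul_iff₀ hC).2 hle

theorem existsUnique_perturbation (hA : IsAccretive A) (hH : IsComplete (H : Set X))
    (hAH : ∀ p ∈ A, p.1 ∈ H) {C K : ℝ} (hC : 0 < C) (hKC : K < C)
    (hsurj : ∀ f ∈ H, ∃ u, (u, f - C • u) ∈ A) {B : X →ₗ[ℝ] X} (hBH : ∀ u ∈ H, B u ∈ H)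
    (hB : ∀ u ∈ H, ‖B u‖ ≤ K * ‖u‖) {f : X} (hf : f ∈ H) :
    ∃! u, (u, f - C • u - B u) ∈ A := by
  obtain ⟨R, hRlip, hR⟩ := hA.exists_resolvent hAH hC hsurj
  let rhs (u : H) : H := ⟨f - B u, H.sub_mem hf (hBH u u.2)⟩
  have hrhs : LipschitzWith K.toNNReal rhs := .of_dist_le_mul fun u u' => by
    calc dist (rhs u) (rhs u') = ‖B (u - u')‖ := by
          rw [Subtype.dist_eq, dist_sub_left, dist_eq_norm, map_sub]
      _ ≤ K * ‖(u : X) - u'‖ := hB _ (H.sub_mem u.2 u'.2)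
      _ ≤ K.toNNReal * dist u u' := by
          rw [Subtype.dist_eq, dist_eq_norm]
          gcongr
          exact K.le_coe_toNNReal
  have hcontr : ContractingWith (C⁻¹.toNNReal * K.toNNReal) (R ∘ rhs) := by
    refine ⟨?_, hRlip.comp hrhs⟩
    rw [← Real.toNNReal_mul (by positivity), Real.toNNReal_lt_one]
    exact (inv_mul_lt_one₀ hC).2 hKC
  have : CompleteSpace H := hH.completeSpace_coe
  have hiff (u : H) : ((u : X), f - C • (u : X) - B u) ∈ A ↔ Function.IsFixedPt (R ∘ rhs) u := by
    rw [sub_right_comm]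
    exact (hR (rhs u) u).trans Subtype.ext_iff.symm
  refine ⟨hcontr.fixedPoint, (hiff _).2 hcontr.fixedPoint_isFixedPt, fun v hv => ?_⟩
  exact congrArg Subtype.val (hcontr.fixedPoint_unique ((hiff ⟨v, hAH _ hv⟩).1 hv))

end IsAccretive

end Accretive

/-! ### The streaming operator in `H0` -/

theorem streamGraph_induction {hG : IsOpen G} {S : Set (L2Jet m G E₀ Eₘ × L2Jet m G E₀ Eₘ)}
    (hS : IsClosed S) (h : ∀ ψ : smoothSubmodule G E₀ Eₘ, (jet m hG ψ, advectJet m hG ψ) ∈ S)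
    {p : L2Jet m G E₀ Eₘ × L2Jet m G E₀ Eₘ} (hp : p ∈ streamGraph m hG E₀ Eₘ) : p ∈ S :=
  closure_minimal (range_subset_iff.2 h) hS hp

theorem mem_H0_of_mem_streamGraph {hG : IsOpen G} {p : L2Jet m G E₀ Eₘ × L2Jet m G E₀ Eₘ}
    (hp : p ∈ streamGraph m hG E₀ Eₘ) : p.1 ∈ H0 m G E₀ Eₘ ∧ p.2 ∈ H0 m G E₀ Eₘ :=
  streamGraph_induction (isClosed_closure.prod isClosed_closure)
    (fun ψ => ⟨mem_H0_of_isL2Jet ψ.2 (isL2Jet_jet hG ψ),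
      mem_H0_of_isL2Jet (advect_mem_smoothSpace hG ψ.2) (isL2Jet_advectJet hG ψ)⟩) hp

theorem integral_mul_of_mem_streamGraph {hG : IsOpen G} {φ : Phase → ℝ} (hφ : IsCxCompact 1 φ)
    (hsupp : ∀ ψ ∈ smoothSpace G E₀ Eₘ,
      phaseSupport G E₀ Eₘ (fun z => ψ z * φ z) ⊆ Prod.fst ⁻¹' G)
    {p : L2Jet m G E₀ Eₘ × L2Jet m G E₀ Eₘ} (hp : p ∈ streamGraph m hG E₀ Eₘ) :
    ∫ z, p.2 (zeroIndex m) z * φ z ∂(phaseMeasure G E₀ Eₘ) =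
      -∫ z, p.1 (zeroIndex m) z * advect φ z ∂(phaseMeasure G E₀ Eₘ) := by
  have hcont {k : ℕ} {χ : Phase → ℝ} (hχ : IsCxCompact k χ) :
      Continuous fun u : L2Jet m G E₀ Eₘ => ∫ z, u (zeroIndex m) z * χ z ∂(phaseMeasure G E₀ Eₘ) :=
    (continuous_integral_mul hχ.memLp_two).comp (PiLp.continuous_apply 2 _ _)
  refine streamGraph_induction
    (S := {p | ∫ z, p.2 (zeroIndex m) z * φ z ∂(phaseMeasure G E₀ Eₘ) =
      -∫ z, p.1 (zeroIndex m) z * advect φ z ∂(phaseMeasure G E₀ Eₘ)})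
    (isClosed_eq ((hcont hφ).comp continuous_snd)
      ((hcont (hφ.dirDeriv continuous_direction)).comp continuous_fst).neg) (fun ψ => ?_) hp
  obtain ⟨⟨f, hf, hψf⟩, -⟩ := ψ.2 1 le_rfl
  calc ∫ z, advectJet m hG ψ (zeroIndex m) z * φ z ∂(phaseMeasure G E₀ Eₘ)
      = ∫ z, advect ψ z * φ z ∂(phaseMeasure G E₀ Eₘ) :=
        integral_congr_ae ((isL2Jet_advectJet hG ψ (zeroIndex m)).mul .rfl)
    _ = -∫ z, (ψ : Phase → ℝ) z * advect φ z ∂(phaseMeasure G E₀ Eₘ) :=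
        integral_dirDeriv_mul hG continuous_direction hf.1 hψf hφ (hsupp ψ ψ.2)
    _ = -∫ z, jet m hG ψ (zeroIndex m) z * advect φ z ∂(phaseMeasure G E₀ Eₘ) :=
        congrArg _ (integral_congr_ae ((isL2Jet_jet hG ψ (zeroIndex m)).symm.mul .rfl))

theorem eq_zero_of_zero_mem_streamGraph {hG : IsOpen G} {w : L2Jet m G E₀ Eₘ}
    (hw : (0, w) ∈ streamGraph m hG E₀ Eₘ) : w = 0 := by
  have hH0 := mem_H0_of_mem_streamGraph hw
  refine eq_of_apply_zeroIndex_ae_eq hG hH0.2 hH0.1 ?_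
  rw [eq_zero_of_integral_test_eq_zero hG (w (zeroIndex m)) fun φ hφ => ?_]
  · rfl
  have hsupp (ψ) (_ : ψ ∈ smoothSpace G E₀ Eₘ) :=
    (phaseSupport_mul_left_subset (G := G) (E₀ := E₀) (Eₘ := Eₘ) (ψ := ψ)).trans <|
      phaseSupport_subset_tsupport.trans hφ.tsupport_subset
  rw [integral_mul_of_mem_streamGraph (hφ.isCxCompact 1) hsupp hw, neg_eq_zero]
  refine integral_eq_zero_of_ae ?_
  filter_upwards [Lp.coeFn_zero ℝ 2 (phaseMeasure G E₀ Eₘ)] with z hz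
  exact mul_eq_zero_of_left hz _

theorem integral_mul_advect_nonneg_of_mem_smoothSpace (hG : IsSmoothConvexDomain G)
    {ψ : Phase → ℝ} (hψ : ψ ∈ smoothSpace G E₀ Eₘ) :
    0 ≤ ∫ z, ψ z * advect ψ z ∂(phaseMeasure G E₀ Eₘ) := by
  obtain ⟨f, hf, hψf, hshadow⟩ := (hψ 1 le_rfl).exists_extension hG
  refine (integral_mul_advect_nonneg hG.isOpen.measurableSet E₀ Eₘ hf hshadow).trans_eq <|
    integral_congr_ae ?_
  filter_upwards [ae_mem_phaseInterior hG.isOpen.measurableSet E₀ Eₘ] with z hz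
  rw [hψf hz, ← dirDeriv_direction, ← dirDeriv_direction,
    dirDeriv_congr (isOpen_phaseInterior hG.isOpen E₀ Eₘ) hψf direction hz]

theorem isAccretive_streamGraph (hG : IsSmoothConvexDomain G) (m : ℕ) (E₀ Eₘ : ℝ) :
    IsAccretive (streamGraph m hG.isOpen E₀ Eₘ) := by
  refine IsAccretive.topologicalClosure ?_
  rintro _ ⟨ψ, rfl⟩
  rw [PiLp.inner_apply]
  refine Finset.sum_nonneg fun α _ => ?_
  rw [L2.inner_def]
  refine (integral_mul_advect_nonneg_of_mem_smoothSpace hG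
    (pdMulti_mem_smoothSpace hG.isOpen α.exps ψ.2)).trans_eq (integral_congr_ae ?_)
  filter_upwards [isL2Jet_jet hG.isOpen ψ α,
    (isL2Jet_advectJet hG.isOpen ψ).advect hG.isOpen ψ.2 α] with z hu hw
  exact congrArg₂ (· * ·) hu.symm hw.symm

theorem exists_mem_streamGraph (hG : IsSmoothConvexDomain G) {C : ℝ} (hC : 0 < C)
    {f : L2Jet m G E₀ Eₘ} (hf : f ∈ H0 m G E₀ Eₘ) :
    ∃ u, (u, f - C • u) ∈ streamGraph m hG.isOpen E₀ Eₘ := by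
  have hclosed := (isAccretive_streamGraph hG m E₀ Eₘ).isClosed_image_add_smul
    (Submodule.isClosed_topologicalClosure _) hC
  have hsmooth : {u | ∃ ψ ∈ smoothSpace G E₀ Eₘ, IsL2Jet ψ u} ⊆
      (fun p : L2Jet m G E₀ Eₘ × L2Jet m G E₀ Eₘ => p.2 + C • p.1) ''
        (streamGraph m hG.isOpen E₀ Eₘ) := by
    rintro f ⟨χ, hχ, hf⟩
    obtain ⟨ψ, hψ, heq⟩ := exists_mem_smoothSpace_advect_add_eq hG hC hχ
    let Ψ : smoothSubmodule G E₀ Eₘ := ⟨ψ, hψ⟩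
    refine ⟨(jet m hG.isOpen Ψ, advectJet m hG.isOpen Ψ), subset_closure ⟨Ψ, rfl⟩, ?_⟩
    exact (((isL2Jet_advectJet hG.isOpen Ψ).add hG.isOpen (advect_mem_smoothSpace hG.isOpen hψ)
      (C • Ψ).2 ((isL2Jet_jet hG.isOpen Ψ).smul hG.isOpen hψ C))).unique
        (hf.congr hG.isOpen hχ heq)
  obtain ⟨p, hp, rfl⟩ := closure_minimal hsmooth hclosed hf
  exact ⟨p.1, by rwa [add_sub_cancel_right]⟩

/-! ### The transport operator -/

/-- The shear `(u, w) ↦ (u, w + Σ u)`, which maps the graph of `ω · ∇ₓ` to that of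
`ω · ∇ₓ + Σ`. -/
def shear (s : LinftyJet m G E₀ Eₘ) :
    (L2Jet m G E₀ Eₘ × L2Jet m G E₀ Eₘ) ≃ₜ (L2Jet m G E₀ Eₘ × L2Jet m G E₀ Eₘ) where
  toFun p := (p.1, p.2 + jetMul s p.1)
  invFun p := (p.1, p.2 - jetMul s p.1)
  left_inv p := by simp only [add_sub_cancel_right]
  right_inv p := by simp only [sub_add_cancel]
  continuous_toFun := by fun_prop
  continuous_invFun := by fun_prop

section OpenDomain

variable {s : LinftyJet m G E₀ Eₘ}

theorem coeFn_shear_zeroIndex (hG : IsOpen G) (s : LinftyJet m G E₀ Eₘ)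
    (ψ : smoothSubmodule G E₀ Eₘ) :
    (shear s (jet m hG ψ, advectJet m hG ψ)).2 (zeroIndex m) =ᵐ[phaseMeasure G E₀ Eₘ]
      fun z => advect ψ z + s (zeroIndex m) z * (ψ : Phase → ℝ) z := by
  filter_upwards [isL2Jet_jet hG ψ (zeroIndex m), isL2Jet_advectJet hG ψ (zeroIndex m),
    coeFn_jetMul_zeroIndex s (jet m hG ψ),
    Lp.coeFn_add (advectJet m hG ψ (zeroIndex m)) (jetMul s (jet m hG ψ) (zeroIndex m))]
    with z hu hw hmul hadd
  refine hadd.trans ?_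
  rw [Pi.add_apply, hmul, hu, hw]
  rfl

theorem shear_mem_transportGraph (hG : IsOpen G) (hs : s ∈ coeffSpace m G E₀ Eₘ)
    (ψ : smoothSubmodule G E₀ Eₘ) :
    shear s (jet m hG ψ, advectJet m hG ψ) ∈ transportGraph s := by
  refine ⟨ψ, ψ.2, isL2Jet_jet hG ψ, ?_, coeFn_shear_zeroIndex hG s ψ⟩
  have hw := mem_H0_of_isL2Jet (advect_mem_smoothSpace hG ψ.2) (isL2Jet_advectJet (m := m) hG ψ)
  have hu := jetMul_mem_H0 hG hs (mem_H0_of_isL2Jet ψ.2 (isL2Jet_jet hG ψ))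
  rw [← coe_H0Submodule hG] at hw hu ⊢
  exact (H0Submodule m hG E₀ Eₘ).add_mem hw hu

theorem exists_mem_transportGraph (hG : IsOpen G) (hs : s ∈ coeffSpace m G E₀ Eₘ) {ψ : Phase → ℝ}
    (hψ : ψ ∈ smoothSpace G E₀ Eₘ) : ∃ p ∈ transportGraph s, IsL2Jet ψ p.1 :=
  ⟨_, shear_mem_transportGraph hG hs ⟨ψ, hψ⟩, isL2Jet_jet hG ⟨ψ, hψ⟩⟩

theorem transportGraph_eq_image_shear (hG : IsOpen G) (hs : s ∈ coeffSpace m G E₀ Eₘ) :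
    transportGraph s = shear s '' range fun ψ => (jet m hG ψ, advectJet m hG ψ) := by
  refine Subset.antisymm ?_ ?_
  · rintro ⟨u, g⟩ ⟨ψ, hψ, hu, hg, heq⟩
    let Ψ : smoothSubmodule G E₀ Eₘ := ⟨ψ, hψ⟩
    obtain ⟨-, -, -, hmem, -⟩ := shear_mem_transportGraph hG hs Ψ
    refine ⟨_, ⟨Ψ, rfl⟩, Prod.ext ((isL2Jet_jet hG Ψ).unique hu) ?_⟩
    exact eq_of_apply_zeroIndex_ae_eq hG hmem hg ((coeFn_shear_zeroIndex hG s Ψ).trans heq.symm)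
  · rintro _ ⟨_, ⟨ψ, rfl⟩, rfl⟩
    exact shear_mem_transportGraph hG hs ψ

theorem mem_closedTransportGraph_iff (hG : IsOpen G) (hs : s ∈ coeffSpace m G E₀ Eₘ)
    {u g : L2Jet m G E₀ Eₘ} :
    (u, g) ∈ closedTransportGraph s ↔ (u, g - jetMul s u) ∈ streamGraph m hG E₀ Eₘ := by
  rw [closedTransportGraph, transportGraph_eq_image_shear hG hs, ← (shear s).image_closure,
    Homeomorph.image_eq_preimage_symm]
  rfl

theorem eq_of_mem_closedTransportGraph (hG : IsOpen G) (hs : s ∈ coeffSpace m G E₀ Eₘ)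
    {u g g' : L2Jet m G E₀ Eₘ} (hg : (u, g) ∈ closedTransportGraph s)
    (hg' : (u, g') ∈ closedTransportGraph s) : g = g' := by
  rw [mem_closedTransportGraph_iff hG hs] at hg hg'
  have hsub := (streamGraph m hG E₀ Eₘ).sub_mem hg hg'
  rw [Prod.mk_sub_mk, sub_self, sub_sub_sub_cancel_right] at hsub
  exact sub_eq_zero.1 (eq_zero_of_zero_mem_streamGraph hsub)

theorem mem_H0_of_mem_closedTransportGraph (hG : IsOpen G) (hs : s ∈ coeffSpace m G E₀ Eₘ)
    {u g : L2Jet m G E₀ Eₘ} (hug : (u, g) ∈ closedTransportGraph s) :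
    u ∈ H0 m G E₀ Eₘ ∧ g ∈ H0 m G E₀ Eₘ := by
  obtain ⟨hu, hw⟩ := mem_H0_of_mem_streamGraph ((mem_closedTransportGraph_iff hG hs).1 hug)
  have hmul := jetMul_mem_H0 hG hs hu
  refine ⟨hu, ?_⟩
  rw [← coe_H0Submodule hG] at hw hmul ⊢
  exact (Submodule.sub_mem_iff_left _ hmul).1 hw

theorem norm_jetMul_le_of_multiplicationBound (hG : IsOpen G) {c : ℝ}
    (hc : MultiplicationBound m G E₀ Eₘ c) (hs : s ∈ coeffSpace m G E₀ Eₘ)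
    {u : L2Jet m G E₀ Eₘ} (hu : u ∈ H0 m G E₀ Eₘ) : ‖jetMul s u‖ ≤ c * ‖s‖ * ‖u‖ := by
  obtain ⟨g, hg, heq, hle⟩ := hc s hs u hu
  have hmul : jetMul s u = g := eq_of_apply_zeroIndex_ae_eq hG (jetMul_mem_H0 hG hs hu) hg
    ((coeFn_jetMul_zeroIndex s u).trans heq.symm)
  rwa [hmul]

end OpenDomain

theorem exists_multiplicationBound (m : ℕ) : ∃ c : ℝ, 0 < c ∧ ∀ (G : Set V3) (E₀ Eₘ : ℝ),
    IsOpen G → MultiplicationBound m G E₀ Eₘ c :=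
  ⟨leibnizConst m, Nat.cast_pos.2 (leibnizConst_pos m), fun _ E₀ Eₘ hG =>
    multiplicationBound_leibnizConst hG m E₀ Eₘ⟩

theorem phaseSupport_mul_subset_preimage (hG : IsSmoothConvexDomain G) {ψ φ : Phase → ℝ}
    (hψ : Disjoint (phaseSupport G E₀ Eₘ ψ) (gammaMinusZero G E₀ Eₘ))
    (hφ : Disjoint (phaseSupport G E₀ Eₘ φ) (gammaPlusZero G E₀ Eₘ)) :
    phaseSupport G E₀ Eₘ (fun z => ψ z * φ z) ⊆ Prod.fst ⁻¹' G := by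
  intro z hz
  by_contra hzG
  obtain ⟨hcl, -, hE⟩ := phaseSupport_subset hz
  have hfr : z.1 ∈ frontier G := hG.isOpen.frontier_eq ▸ ⟨hcl, hzG⟩
  obtain ⟨n, hn⟩ := hG.exists_outwardNormal hfr
  rcases le_total (inner ℝ (z.2.1 : V3) n) 0 with hle | hle
  · exact hψ.notMem_of_mem_left (phaseSupport_mul_right_subset hz) ⟨hfr, hE, n, hn, hle⟩
  · exact hφ.notMem_of_mem_left (phaseSupport_mul_left_subset hz) ⟨hfr, hE, n, hn, hle⟩

section StrongSolution

variable {s : LinftyJet m G E₀ Eₘ} {C : ℝ} {f : L2Jet m G E₀ Eₘ}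

theorem isStrongSolution_iff (hG : IsOpen G) (hs : s ∈ coeffSpace m G E₀ Eₘ)
    {u : L2Jet m G E₀ Eₘ} :
    IsStrongSolution s C f u ↔ (u, f - C • u - jetMul s u) ∈ streamGraph m hG E₀ Eₘ :=
  mem_closedTransportGraph_iff hG hs

theorem existsUnique_isStrongSolution (hG : IsSmoothConvexDomain G)
    (hs : s ∈ coeffSpace m G E₀ Eₘ) {c : ℝ} (hc₀ : 0 < c) (hc : MultiplicationBound m G E₀ Eₘ c)
    (hC : c * ‖s‖ < C) (hf : f ∈ H0 m G E₀ Eₘ) : ∃! u, IsStrongSolution s C f u := by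
  have hC₀ : 0 < C := (mul_nonneg hc₀.le (norm_nonneg s)).trans_lt hC
  have hH {u : L2Jet m G E₀ Eₘ} : u ∈ H0Submodule m hG.isOpen E₀ Eₘ ↔ u ∈ H0 m G E₀ Eₘ := by
    rw [← coe_H0Submodule hG.isOpen, SetLike.mem_coe]
  simp only [isStrongSolution_iff hG.isOpen hs]
  exact (isAccretive_streamGraph hG m E₀ Eₘ).existsUnique_perturbation
    (Submodule.isClosed_topologicalClosure _).isComplete
    (fun p hp => hH.2 (mem_H0_of_mem_streamGraph hp).1) hC₀ hC
    (fun f hf => exists_mem_streamGraph hG hC₀ (hH.1 hf)) (B := (jetMul s).toLinearMap)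
    (fun u hu => hH.2 (jetMul_mem_H0 hG.isOpen hs (hH.1 hu)))
    (fun u hu => norm_jetMul_le_of_multiplicationBound hG.isOpen hc hs (hH.1 hu)) (hH.2 hf)

theorem setOf_add_smul_eq_H0 (hG : IsSmoothConvexDomain G)
    (hs : s ∈ coeffSpace m G E₀ Eₘ) {c : ℝ} (hc₀ : 0 < c) (hc : MultiplicationBound m G E₀ Eₘ c)
    (hC : c * ‖s‖ < C) :
    {f | ∃ u g, (u, g) ∈ closedTransportGraph s ∧ f = g + C • u} = H0 m G E₀ Eₘ := by
  refine Subset.antisymm ?_ fun f hf => ?_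
  · rintro _ ⟨u, g, hug, rfl⟩
    have hmem := mem_H0_of_mem_closedTransportGraph hG.isOpen hs hug
    rw [← coe_H0Submodule hG.isOpen] at hmem ⊢
    exact Submodule.add_mem _ hmem.2 (Submodule.smul_mem _ C hmem.1)
  · obtain ⟨u, hu, -⟩ := existsUnique_isStrongSolution hG hs hc₀ hc hC hf
    exact ⟨u, f - C • u, hu, (sub_add_cancel _ _).symm⟩

theorem IsStrongSolution.mem_H0 (hG : IsOpen G) (hs : s ∈ coeffSpace m G E₀ Eₘ)
    {u : L2Jet m G E₀ Eₘ} (hu : IsStrongSolution s C f u) : u ∈ H0 m G E₀ Eₘ :=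
  (mem_H0_of_mem_closedTransportGraph hG hs hu).1

theorem IsStrongSolution.solvesInflowProblem (hG : IsSmoothConvexDomain G)
    (hs : s ∈ coeffSpace m G E₀ Eₘ) {u : L2Jet m G E₀ Eₘ} (hu : IsStrongSolution s C f u) :
    SolvesInflowProblem s C f u := by
  intro φ hφ hφd
  rw [← integral_mul_of_mem_streamGraph hφ
    (fun ψ hψ => phaseSupport_mul_subset_preimage hG (hψ 1 le_rfl).2 hφd)
    ((isStrongSolution_iff hG.isOpen hs).1 hu)]
  refine integral_congr_ae ?_
  filter_upwards [coeFn_jetMul_zeroIndex s u, Lp.coeFn_smul C (u (zeroIndex m)),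
    Lp.coeFn_sub (f (zeroIndex m)) (C • u (zeroIndex m)),
    Lp.coeFn_sub (f (zeroIndex m) - C • u (zeroIndex m)) (jetMul s u (zeroIndex m))]
    with z hmul hsmul hsub hsub'
  rw [PiLp.sub_apply, PiLp.sub_apply, PiLp.smul_apply, hsub', Pi.sub_apply, hsub, Pi.sub_apply,
    hsmul, Pi.smul_apply, hmul, smul_eq_mul, sub_right_comm]

end StrongSolution

end Transport

end

theorem theorem3p6_general (m : ℕ) :
    (∃ c : ℝ, 0 < c ∧ ∀ (G : Set Transport.V3) (E₀ Eₘ : ℝ),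
      IsOpen G → Transport.MultiplicationBound m G E₀ Eₘ c) ∧
    ∀ (G : Set Transport.V3) (E₀ Eₘ : ℝ),
      Transport.IsSmoothConvexDomain G →
      ∀ s ∈ Transport.coeffSpace m G E₀ Eₘ,
        (∀ ψ ∈ Transport.smoothSpace G E₀ Eₘ,
          ∃ p ∈ Transport.transportGraph s, Transport.IsL2Jet ψ p.1) ∧
        (∀ u g g' : Transport.L2Jet m G E₀ Eₘ,
          (u, g) ∈ Transport.closedTransportGraph s →
          (u, g') ∈ Transport.closedTransportGraph s → g = g') ∧
        ∀ c : ℝ, 0 < c → Transport.MultiplicationBound m G E₀ Eₘ c →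
          ∀ C : ℝ, c * ‖s‖ < C →
            {f | ∃ u g : Transport.L2Jet m G E₀ Eₘ,
              (u, g) ∈ Transport.closedTransportGraph s ∧ f = g + C • u} =
                Transport.H0 m G E₀ Eₘ ∧
            ∀ f ∈ Transport.H0 m G E₀ Eₘ,
              (∃! u : Transport.L2Jet m G E₀ Eₘ, Transport.IsStrongSolution s C f u) ∧
              ∀ u : Transport.L2Jet m G E₀ Eₘ, Transport.IsStrongSolution s C f u →
                u ∈ Transport.H0 m G E₀ Eₘ ∧ Transport.SolvesInflowProblem s C f u := by
  refine ⟨Transport.exists_multiplicationBound m, fun G E₀ Eₘ hG s hs => ⟨?_, ?_, ?_⟩⟩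
  · exact fun ψ hψ => Transport.exists_mem_transportGraph hG.isOpen hs hψ
  · exact fun u g g' => Transport.eq_of_mem_closedTransportGraph hG.isOpen hs
  · refine fun c hc₀ hc C hC => ⟨Transport.setOf_add_smul_eq_H0 hG hs hc₀ hc hC, fun f hf => ?_⟩
    refine ⟨Transport.existsUnique_isStrongSolution hG hs hc₀ hc hC hf, fun u hu => ?_⟩
    exact ⟨hu.mem_H0 hG.isOpen hs, hu.solvesInflowProblem hG hs⟩

theorem theorem3p6 (m : ℕ) :
    -- a multiplication constant `c(m)` that depends on `m` only exists
    (∃ c : ℝ, 0 < c ∧ ∀ (G : Set Transport.V3) (E₀ Eₘ : ℝ),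
      Transport.IsSmoothStrictlyConvexDomain G → 0 ≤ E₀ → E₀ < Eₘ →
        Transport.MultiplicationBound m G E₀ Eₘ c) ∧
    ∀ (G : Set Transport.V3) (E₀ Eₘ : ℝ),
      Transport.IsSmoothStrictlyConvexDomain G → 0 ≤ E₀ → E₀ < Eₘ →
      ∀ s ∈ Transport.coeffSpace m G E₀ Eₘ,
        -- `P_m` is defined on the whole of its domain, and its closure is single-valued
        (∀ ψ ∈ Transport.smoothSpace G E₀ Eₘ,
          ∃ p ∈ Transport.transportGraph s, Transport.IsL2Jet ψ p.1) ∧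
        (∀ u g g' : Transport.L2Jet m G E₀ Eₘ,
          (u, g) ∈ Transport.closedTransportGraph s →
          (u, g') ∈ Transport.closedTransportGraph s → g = g') ∧
        -- the range of the closure plus `C`, and the unique strong solution
        ∀ c : ℝ, 0 < c → Transport.MultiplicationBound m G E₀ Eₘ c →
          ∀ C : ℝ, c * ‖s‖ < C →
            {f | ∃ u g : Transport.L2Jet m G E₀ Eₘ,
              (u, g) ∈ Transport.closedTransportGraph s ∧ f = g + C • u} =
                Transport.H0 m G E₀ Eₘ ∧
            ∀ f ∈ Transport.H0 m G E₀ Eₘ,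
              (∃! u : Transport.L2Jet m G E₀ Eₘ, Transport.IsStrongSolution s C f u) ∧
              ∀ u : Transport.L2Jet m G E₀ Eₘ, Transport.IsStrongSolution s C f u →
                u ∈ Transport.H0 m G E₀ Eₘ ∧ Transport.SolvesInflowProblem s C f u := by
  obtain ⟨⟨c, hc₀, hc⟩, hsolve⟩ := theorem3p6_general m
  exact ⟨⟨c, hc₀, fun G E₀ Eₘ hG _ _ => hc G E₀ Eₘ hG.isOpen⟩,
    fun G E₀ Eₘ hG _ _ => hsolve G E₀ Eₘ hG.isSmoothConvexDomain⟩
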